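/- **Theorem (Uniqueness of the Kähler metric).** Let $M$ be a compact connected complex manifold of complex dimension $n$, and let $g$ be a Kähler metric on $M$, i.e. a smooth Riemannian metric with $g(JX,JY)=g(X,Y)$, where $J$ is the complex structure, whose associated form $\omega(X,Y)=g(JX,Y)$ is closed. Write $dV_g$ for the Riemannian volume and $g_{i\bar j}=g(\partial/\partial z^i,\partial/\partial\bar z^j)$ in local holomorphic coordinates ($g$ extended complex bilinearly, so that $\omega=i\sum g_{i\bar j}\,dz^i\wedge d\bar z^j$). Let $F:M\to\mathbb R$ be a smooth function and let $C>0$ be the constant determined by $C\int_M e^{F}\,dV_g=\mathrm{Vol}_g(M)$. Let $\varphi_1,\varphi_2:M\to\mathbb R$ be functions of class $C^3$ such that, for $k=1,2$, $\int_M\varphi_k\,dV_g=0$ and, in local holomorphic coordinates, $$\det\Bigl(g_{i\bar j}+\frac{\partial^2\varphi_k}{\partial z^i\,\partial\bar z^j}\Bigr)=C\,e^{F}\det\bigl(g_{i\bar j}\bigr).$$ Then $\varphi_1=\varphi_2$. -/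

import Mathlib

open scoped Manifold ContDiff Topology Bundle

noncomputable section

namespace KahlerUniqueness

/-- `ℂⁿ`, the model space of complex manifolds of complex dimension `n`.  Only its structure of a
finite-dimensional vector space matters; its Lebesgue measure is `dx₁ dy₁ ⋯ dxₙ dyₙ`. -/
abbrev Cn (n : ℕ) : Type := Fin n → ℂ

section Manifold

variable {n : ℕ} {M : Type*} [TopologicalSpace M] [ChartedSpace (Cn n) M]

/-- The smooth real manifold underlying a complex manifold (holomorphic, that is complex analytic,
transition maps are in particular real `C^k`). -/
instance realManifold [IsManifold 𝓘(ℂ, Cn n) ω M] (k : ℕ∞ω) : IsManifold 𝓘(ℝ, Cn n) k M := by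
  refine isManifold_of_contDiffOn _ _ _ fun e e' he he' => ?_
  have h := (contDiffGroupoid ω 𝓘(ℂ, Cn n)).compatible he he'
  rw [contDiffGroupoid, mem_groupoid_of_pregroupoid] at h
  have h1 : ContDiffOn ℂ ω _ _ := h.1
  exact (h1.restrict_scalars ℝ).of_le le_top

/-- The complex structure `J` on the real tangent space.  Mathlib identifies the tangent space at
`x` with `ℂⁿ` through the derivative of the preferred holomorphic chart at `x`, and `J` is
multiplication by `i` there; the derivatives of the transition maps are complex linear, so
every other holomorphic chart gives the same `J`. -/
def complexStructure (x : M) :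
    TangentSpace 𝓘(ℝ, Cn n) x →L[ℝ] TangentSpace 𝓘(ℝ, Cn n) x :=
  (Complex.I • ContinuousLinearMap.id ℝ (Cn n) : Cn n →L[ℝ] Cn n)

theorem complexStructure_sq (x : M) (v : TangentSpace 𝓘(ℝ, Cn n) x) :
    complexStructure x (complexStructure x v) = -v := by
  have h (u : Cn n) : Complex.I • (Complex.I • u) = -u := by
    rw [smul_smul, Complex.I_mul_I, neg_one_smul]
  exact h v

variable (n M) in
/-- A (smooth) Hermitian metric on a complex manifold: a Riemannian metric `g` on the real tangent
bundle with `g(JX, JY) = g(X, Y)`. -/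
structure HermitianMetric [IsManifold 𝓘(ℂ, Cn n) ω M] extends
    Bundle.ContMDiffRiemannianMetric 𝓘(ℝ, Cn n) ∞ (Cn n)
      (fun x : M => TangentSpace 𝓘(ℝ, Cn n) x) where
  inner_J (x : M) (v w : TangentSpace 𝓘(ℝ, Cn n) x) :
    inner x (complexStructure x v) (complexStructure x w) = inner x v w

namespace HermitianMetric

variable [IsManifold 𝓘(ℂ, Cn n) ω M] (g : HermitianMetric n M)

/-- The real 2-form `ω(v, w) = g(Jv, w)` associated with a Hermitian metric. -/
def form (x : M) : TangentSpace 𝓘(ℝ, Cn n) x [⋀^Fin 2]→L[ℝ] ℝ where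
  toFun v := g.inner x (complexStructure x (v 0)) (v 1)
  map_update_add' v i a b := by
    fin_cases i <;> simp [Function.update]
  map_update_smul' v i c a := by
    fin_cases i <;> simp [Function.update]
  map_eq_zero_of_eq' v i j hv hij := by
    have h01 : v 0 = v 1 := by
      fin_cases i <;> fin_cases j <;> simp_all
    have h : g.inner x (complexStructure x (v 0)) (v 0)
        = -g.inner x (complexStructure x (v 0)) (v 0) := by
      conv_lhs => rw [← g.inner_J, complexStructure_sq, map_neg,
        neg_apply, g.symm]
    simp only [← h01]
    linarith
  cont := by
    let B : Cn n →L[ℝ] Cn n →L[ℝ] ℝ := g.inner x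
    let j : Cn n →L[ℝ] Cn n := complexStructure x
    have h : Continuous fun v : Fin 2 → Cn n => B (j (v 0)) (v 1) := by fun_prop
    exact h

/-- The associated 2-form in a chart `e` of the manifold: its pullback by `e.symm`. -/
def localForm (e : OpenPartialHomeomorph M (Cn n)) (z : Cn n) : Cn n [⋀^Fin 2]→L[ℝ] ℝ :=
  (g.form (e.symm z)).compContinuousLinearMap (mfderiv 𝓘(ℝ, Cn n) 𝓘(ℝ, Cn n) e.symm z)

/-- `g` is a Kähler metric: the associated form `ω` is closed, `dω = 0`, in every chart. -/
def IsKahler : Prop :=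
  ∀ e ∈ atlas (Cn n) M, ∀ z ∈ e.target, extDeriv (g.localForm e) z = 0

/-- The Riemannian metric in a chart `e`: the pullback of `g` by `e.symm`. -/
def localMetric (e : OpenPartialHomeomorph M (Cn n)) (z v w : Cn n) : ℝ :=
  g.inner (e.symm z) (mfderiv 𝓘(ℝ, Cn n) 𝓘(ℝ, Cn n) e.symm z v)
    (mfderiv 𝓘(ℝ, Cn n) 𝓘(ℝ, Cn n) e.symm z w)

end HermitianMetric

/-- The coordinate vector `∂/∂xⱼ` of `ℂⁿ`. -/
def ex (j : Fin n) : Cn n := Pi.single j 1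

/-- The coordinate vector `∂/∂yⱼ` of `ℂⁿ`. -/
def ey (j : Fin n) : Cn n := Pi.single j Complex.I

/-- The Wirtinger derivative `∂/∂zⱼ = ½ (∂/∂xⱼ - i ∂/∂yⱼ)`. -/
def dz (j : Fin n) (f : Cn n → ℂ) (z : Cn n) : ℂ :=
  1 / 2 * (fderiv ℝ f z (ex j) - Complex.I * fderiv ℝ f z (ey j))

/-- The Wirtinger derivative `∂/∂z̄ⱼ = ½ (∂/∂xⱼ + i ∂/∂yⱼ)`. -/
def dzbar (j : Fin n) (f : Cn n → ℂ) (z : Cn n) : ℂ :=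
  1 / 2 * (fderiv ℝ f z (ex j) + Complex.I * fderiv ℝ f z (ey j))

/-- The complex Hessian `(∂²φ/∂zⁱ∂z̄ʲ)` of a real function `φ` on `M` in the chart `e`. -/
def complexHessian (φ : M → ℝ) (e : OpenPartialHomeomorph M (Cn n)) (z : Cn n) :
    Matrix (Fin n) (Fin n) ℂ :=
  Matrix.of fun i j => dz i (dzbar j fun w => (φ (e.symm w) : ℂ)) z

namespace HermitianMetric

variable [IsManifold 𝓘(ℂ, Cn n) ω M] (g : HermitianMetric n M)

/-- The matrix `g_{ij̄} = g(∂/∂zⁱ, ∂/∂z̄ʲ)` in the chart `e`, where `g` is extended complex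
bilinearly to the complexified tangent space: it is
`¼ g(∂/∂xᵢ - i ∂/∂yᵢ, ∂/∂xⱼ + i ∂/∂yⱼ)`, so that `ω = i ∑ g_{ij̄} dzⁱ ∧ dz̄ʲ`. -/
def coeff (e : OpenPartialHomeomorph M (Cn n)) (z : Cn n) : Matrix (Fin n) (Fin n) ℂ :=
  Matrix.of fun i j =>
    1 / 4 * ((g.localMetric e z (ex i) (ex j) : ℂ) + g.localMetric e z (ey i) (ey j)
      + Complex.I * (g.localMetric e z (ex i) (ey j) - g.localMetric e z (ey i) (ex j)))

/-- The density `√ det (g_{μν})` of the Riemannian volume in the chart `e`, with respect to the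
real coordinates `x₁, …, xₙ, y₁, …, yₙ`. -/
def volumeDensity (e : OpenPartialHomeomorph M (Cn n)) (z : Cn n) : ℝ :=
  √(Matrix.det (Matrix.of fun a b : Fin n ⊕ Fin n =>
    g.localMetric e z (Sum.elim ex ey a) (Sum.elim ex ey b)))

variable (n M) in
/-- A smooth partition of unity subordinate to the chart domains. -/
def chartPartition [T2Space M] [SigmaCompactSpace M] :
    SmoothPartitionOfUnity M 𝓘(ℝ, Cn n) M Set.univ :=
  (SmoothPartitionOfUnity.exists_isSubordinate_chartAt_source 𝓘(ℝ, Cn n) M).choose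

/-- The Riemannian volume measure `dV_g`, `∫ f dV_g = ∑ᵢ ∫ (ρᵢ f √det g) dx dy`, glued from its
expressions in charts by a partition of unity `(ρᵢ)` subordinate to the chart domains.  (By the
change of variables formula it does not depend on the partition of unity.) -/
def volumeMeasure [T2Space M] [SigmaCompactSpace M] [MeasurableSpace M] :
    MeasureTheory.Measure M :=
  MeasureTheory.Measure.sum fun p : M =>
    (((MeasureTheory.volume : MeasureTheory.Measure (Cn n)).restrict
        (chartAt (Cn n) p).target).withDensity fun z =>
      ENNReal.ofReal (chartPartition n M p ((chartAt (Cn n) p).symm z)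
        * g.volumeDensity (chartAt (Cn n) p) z)).map (chartAt (Cn n) p).symm

/-- The complex Monge–Ampère equation `det (g_{ij̄} + ∂²φ/∂zⁱ∂z̄ʲ) = C e^F det (g_{ij̄})`,
required in every holomorphic chart of the atlas. -/
def SolvesMongeAmpere (F : M → ℝ) (C : ℝ) (φ : M → ℝ) : Prop :=
  ∀ e ∈ atlas (Cn n) M, ∀ z ∈ e.target,
    (g.coeff e z + complexHessian φ e z).det
      = (C * Real.exp (F (e.symm z)) : ℝ) * (g.coeff e z).det

end HermitianMetric

end Manifold

end KahlerUniqueness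

end

noncomputable section

namespace KahlerUniqueness

set_option synthInstance.maxHeartbeats 400000

open Matrix
open scoped ComplexOrder

/-! ### Positive definite matrices and the determinant inequality. -/

section LinearAlgebra

variable {ι : Type*} [Fintype ι] [DecidableEq ι]

/-! Write `A_k` for the matrix `g_{ij̄} + ∂²φ_k/∂zⁱ∂z̄ʲ`. It is positive definite everywhere: at a
minimum of `φ_k` the complex Hessian is positive semidefinite, and along the connected manifold
positivity can only be lost through a zero of the determinant, which the equation excludes
(`SolvesMongeAmpere.posDef`).

Since `det A₁ = det A₂`, the arithmetic-geometric mean inequality for the eigenvalues of `A₂⁻¹A₁`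
gives `tr (A₂⁻¹ (A₁ - A₂)) ≥ 0` (`trace_inv_mul_sub_nonneg`). The metric cancels in `A₁ - A₂`, so `u
= φ₁ - φ₂` satisfies the linear elliptic inequality `tr (A₂⁻¹ ∂∂̄u) ≥ 0`. By compactness `u` has a
maximum, and the strong maximum principle (`eventually_eq_of_isMax`, proved through the Hopf lemma)
makes the set where it is attained open. That set is also closed, so `u` is constant.

The constant has integral zero against a finite nonzero volume, hence vanishes. -/

theorem _root_.Matrix.PosDef.exists_conjTranspose_mul_self {P : Matrix ι ι ℂ} (hP : P.PosDef) :
    ∃ T : Matrix ι ι ℂ, P = Tᴴ * T := by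
  open scoped MatrixOrder in
  obtain ⟨T, hT⟩ := CStarAlgebra.nonneg_iff_eq_star_mul_self.mp hP.posSemidef.nonneg
  exact ⟨T, hT⟩

/-- With `P = Tᴴ * T`, cyclicity turns the trace into that of the positive semidefinite matrix `T *
H * Tᴴ`. -/
theorem trace_mul_nonneg {P H : Matrix ι ι ℂ} (hP : P.PosDef) (hH : H.PosSemidef) :
    0 ≤ (P * H).trace := by
  obtain ⟨T, rfl⟩ := hP.exists_conjTranspose_mul_self
  rw [Matrix.mul_assoc, Matrix.trace_mul_comm]
  exact (hH.mul_mul_conjTranspose_same T).trace_nonneg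

/-- The inequality of arithmetic and geometric means for the eigenvalues of a matrix. -/
theorem card_le_trace_of_det_eq_one {A : Matrix ι ι ℂ} (hA : A.PosDef) (h : A.det = 1) :
    (Fintype.card ι : ℝ) ≤ A.trace.re := by
  have hpos := hA.eigenvalues_pos
  have hprod : ∏ i, hA.isHermitian.eigenvalues i = 1 := by
    have := hA.isHermitian.det_eq_prod_eigenvalues
    rw [h] at this
    simp only [Complex.coe_algebraMap] at this
    exact_mod_cast this.symm
  rw [hA.isHermitian.trace_eq_sum_eigenvalues]
  have hlog : ∑ i, Real.log (hA.isHermitian.eigenvalues i) = 0 := by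
    rw [← Real.log_prod fun i _ => (hpos i).ne', hprod, Real.log_one]
  -- The tangent line bound `log x ≤ x - 1`, summed; the logarithms add up to zero.
  have : ∑ i, Real.log (hA.isHermitian.eigenvalues i)
      ≤ ∑ i, (hA.isHermitian.eigenvalues i - 1) :=
    Finset.sum_le_sum fun i _ => Real.log_le_sub_one_of_pos (hpos i)
  rw [hlog, Finset.sum_sub_distrib] at this
  simp at this
  simpa using this

/-- The tangent plane inequality for the concave function `log det`. With `B⁻¹ = Tᴴ * T`, the matrix
`T * A * Tᴴ` is positive definite of determinant one and has the trace of `B⁻¹ * A`, so its trace is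
at least the dimension, which is the trace of `B⁻¹ * B`. -/
theorem trace_inv_mul_sub_nonneg {A B : Matrix ι ι ℂ} (hA : A.PosDef) (hB : B.PosDef)
    (h : A.det = B.det) : 0 ≤ (B⁻¹ * (A - B)).trace.re := by
  obtain ⟨T, hT⟩ := hB.inv.exists_conjTranspose_mul_self
  have hBdet : IsUnit B.det := (Matrix.isUnit_iff_isUnit_det _).mp hB.isUnit
  have hdet : (star T.det) * T.det * B.det = 1 := by
    have : (B⁻¹ * B).det = 1 := by rw [Matrix.nonsing_inv_mul _ hBdet, det_one]
    rwa [hT, det_mul, det_mul, det_conjTranspose] at this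
  have hTdet : IsUnit T.det := by
    refine isUnit_iff_ne_zero.mpr fun h0 => ?_
    simp [h0] at hdet
  have hTu : IsUnit T := (Matrix.isUnit_iff_isUnit_det _).mpr hTdet
  have hpd : (T * A * Tᴴ).PosDef :=
    hA.mul_mul_conjTranspose_same (Matrix.vecMul_injective_of_isUnit hTu)
  have h1 := card_le_trace_of_det_eq_one hpd (by
    rw [det_mul, det_mul, det_conjTranspose, h, ← hdet]; ring)
  have h2 : (B⁻¹ * A).trace = (T * A * Tᴴ).trace := by
    rw [hT, Matrix.mul_assoc, Matrix.trace_mul_comm]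
  rw [Matrix.mul_sub, Matrix.nonsing_inv_mul _ hBdet, trace_sub, h2, Complex.sub_re, trace_one]
  simpa using h1

/-- By homogeneity it suffices to test unit vectors, and the unit sphere is compact. -/
theorem isOpen_setOf_forall_pos {X E : Type*} [TopologicalSpace X] [NormedAddCommGroup E]
    [NormedSpace ℝ E] [ProperSpace E] {q : X → E → ℝ} (hq : Continuous fun p : X × E => q p.1 p.2)
    (hsmul : ∀ x (c : ℝ) v, q x (c • v) = c ^ 2 * q x v) :
    IsOpen {x | ∀ v ≠ 0, 0 < q x v} := by
  have key : {x | ∀ v ≠ 0, 0 < q x v} = {x | ∀ v ∈ Metric.sphere (0 : E) 1, 0 < q x v} := by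
    ext x
    refine ⟨fun h v hv => h v fun h0 => by simp [h0] at hv, fun h v hv => ?_⟩
    have h1 := h (‖v‖⁻¹ • v) (by simp [norm_smul, hv])
    rw [hsmul] at h1
    exact pos_of_mul_pos_right h1 (by positivity)
  rw [key, isOpen_iff_eventually]
  intro x hx
  refine (isCompact_sphere _ _).eventually_forall_of_forall_eventually fun v hv => ?_
  exact hq.continuousAt.eventually (lt_mem_nhds (hx v hv))

end LinearAlgebra

/-! ### Hermitian matrices of real bilinear forms. -/

section Levi

variable {n : ℕ}

/-- The Hermitian matrix `B(∂/∂zⁱ, ∂/∂z̄ʲ)` of a real bilinear form `B` on `ℂⁿ`. -/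
def levi (B : Cn n →L[ℝ] Cn n →L[ℝ] ℝ) : Matrix (Fin n) (Fin n) ℂ :=
  Matrix.of fun i j => 1 / 4 * ((B (ex i) (ex j) : ℂ) + B (ey i) (ey j)
    + Complex.I * (B (ex i) (ey j) - B (ey i) (ex j)))

theorem levi_add (B B' : Cn n →L[ℝ] Cn n →L[ℝ] ℝ) : levi (B + B') = levi B + levi B' := by
  ext i j
  simp only [levi, Matrix.of_apply, Matrix.add_apply, _root_.add_apply, Complex.ofReal_add]
  ring

theorem levi_smul (c : ℝ) (B : Cn n →L[ℝ] Cn n →L[ℝ] ℝ) : levi (c • B) = c • levi B := by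
  ext i j
  simp only [levi, Matrix.of_apply, Matrix.smul_apply, _root_.smul_apply, smul_eq_mul,
    Complex.ofReal_mul, Complex.real_smul]
  ring

theorem levi_neg (B : Cn n →L[ℝ] Cn n →L[ℝ] ℝ) : levi (-B) = -levi B := by
  rw [← neg_one_smul ℝ B, levi_smul, neg_one_smul]

theorem levi_sub (B B' : Cn n →L[ℝ] Cn n →L[ℝ] ℝ) : levi (B - B') = levi B - levi B' := by
  rw [sub_eq_add_neg B, levi_add, levi_neg, sub_eq_add_neg]

theorem continuous_levi : Continuous (levi : (Cn n →L[ℝ] Cn n →L[ℝ] ℝ) → _) := by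
  unfold levi
  refine continuous_matrix fun i j => ?_
  simp only [Matrix.of_apply]
  fun_prop

theorem isHermitian_levi {B : Cn n →L[ℝ] Cn n →L[ℝ] ℝ} (hB : ∀ v w, B v w = B w v) :
    (levi B).IsHermitian := by
  ext i j
  simp only [levi, Matrix.conjTranspose_apply, Matrix.of_apply]
  rw [hB (ex j) (ex i), hB (ey j) (ey i), hB (ex j) (ey i), hB (ey j) (ex i)]
  apply Complex.ext
  · simp
  · simp

theorem eq_sum_ex_ey (v : Cn n) : v = ∑ i, ((v i).re • ex i + (v i).im • ey i) := by
  funext k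
  simp only [Finset.sum_apply, Pi.add_apply, Pi.smul_apply, ex, ey, Pi.single_apply, smul_ite,
    smul_zero, Finset.sum_add_distrib, Finset.sum_ite_eq, Finset.mem_univ, if_true,
    Complex.real_smul, mul_one]
  exact (Complex.re_add_im _).symm

theorem bilin_apply_eq_sum (B : Cn n →L[ℝ] Cn n →L[ℝ] ℝ) (v w : Cn n) :
    B v w = ∑ i, ∑ j, ((v i).re * (w j).re * B (ex i) (ex j)
      + (v i).re * (w j).im * B (ex i) (ey j) + (v i).im * (w j).re * B (ey i) (ex j)
      + (v i).im * (w j).im * B (ey i) (ey j)) := by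
  conv_lhs => rw [eq_sum_ex_ey v, eq_sum_ex_ey w]
  rw [map_sum B, _root_.sum_apply]
  simp only [map_sum, map_add, map_smul, _root_.add_apply,
    _root_.smul_apply, smul_eq_mul]
  refine Finset.sum_congr rfl fun i _ => ?_
  refine Finset.sum_congr rfl fun j _ => ?_
  ring

/-- The left side is the real part of `B(Z, Z̄)` for `Z = ∑ x̄ᵢ ∂/∂zⁱ = ½ (v - iJv)` with `v = star
x`; this is where the conjugate comes from. -/
theorem re_star_dotProduct_levi (B : Cn n →L[ℝ] Cn n →L[ℝ] ℝ) (x : Cn n) :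
    (star x ⬝ᵥ (levi B *ᵥ x)).re
      = 1 / 4 * (B (star x) (star x) + B (Complex.I • star x) (Complex.I • star x)) := by
  rw [bilin_apply_eq_sum B (star x), bilin_apply_eq_sum B (Complex.I • star x)]
  simp only [dotProduct, mulVec, Finset.mul_sum, Complex.re_sum, ← Finset.sum_add_distrib]
  refine Finset.sum_congr rfl fun i _ => Finset.sum_congr rfl fun j _ => ?_
  simp [levi]
  ring

/-- This real criterion replaces the matrix in the arguments on openness and on change of charts. -/
theorem posDef_levi_iff {B : Cn n →L[ℝ] Cn n →L[ℝ] ℝ} (hB : ∀ v w, B v w = B w v) :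
    (levi B).PosDef ↔ ∀ v ≠ 0, 0 < B v v + B (Complex.I • v) (Complex.I • v) := by
  refine ⟨fun h v hv => ?_, fun h => ?_⟩
  · have h1 := (Complex.pos_iff.mp (h.dotProduct_mulVec_pos (x := star v) (by simpa using hv))).1
    rw [re_star_dotProduct_levi, star_star] at h1
    linarith
  · refine .of_dotProduct_mulVec_pos (isHermitian_levi hB) fun x hx => ?_
    rw [Complex.pos_iff]
    refine ⟨?_, ((isHermitian_levi hB).im_star_dotProduct_mulVec_self x).symm⟩
    rw [re_star_dotProduct_levi]
    have := h (star x) (by simpa using hx)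
    linarith

theorem posSemidef_levi_iff {B : Cn n →L[ℝ] Cn n →L[ℝ] ℝ} (hB : ∀ v w, B v w = B w v) :
    (levi B).PosSemidef ↔ ∀ v, 0 ≤ B v v + B (Complex.I • v) (Complex.I • v) := by
  refine ⟨fun h v => ?_, fun h => ?_⟩
  · have h1 := (Complex.nonneg_iff.mp (h.dotProduct_mulVec_nonneg (star v))).1
    rw [re_star_dotProduct_levi, star_star] at h1
    linarith
  · refine .of_dotProduct_mulVec_nonneg (isHermitian_levi hB) fun x => ?_
    rw [Complex.nonneg_iff]
    refine ⟨?_, ((isHermitian_levi hB).im_star_dotProduct_mulVec_self x).symm⟩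
    rw [re_star_dotProduct_levi]
    have := h (star x)
    linarith

theorem isOpen_setOf_posDef_levi {X : Type*} [TopologicalSpace X]
    {B : X → Cn n →L[ℝ] Cn n →L[ℝ] ℝ} (hB : Continuous B) (hs : ∀ x v w, B x v w = B x w v) :
    IsOpen {x | (levi (B x)).PosDef} := by
  simp only [posDef_levi_iff (hs _)]
  refine isOpen_setOf_forall_pos (q := fun x v => B x v v + B x (Complex.I • v) (Complex.I • v))
    (by fun_prop) fun x c v => ?_
  simp only [smul_comm Complex.I c v, map_smul, _root_.smul_apply, smul_eq_mul]
  ring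

theorem isClosed_setOf_posSemidef_levi {X : Type*} [TopologicalSpace X]
    {B : X → Cn n →L[ℝ] Cn n →L[ℝ] ℝ} (hB : Continuous B) (hs : ∀ x v w, B x v w = B x w v) :
    IsClosed {x | (levi (B x)).PosSemidef} := by
  simp only [posSemidef_levi_iff (hs _), Set.ofPred_forall]
  exact isClosed_iInter fun v => isClosed_le continuous_const (by fun_prop)

/-- A positive semidefinite complex matrix with nonzero determinant is positive definite. -/
theorem _root_.Matrix.PosSemidef.posDef_of_det_ne_zero {ι : Type*} [Fintype ι] [DecidableEq ι]
    {A : Matrix ι ι ℂ} (hA : A.PosSemidef) (h : A.det ≠ 0) : A.PosDef :=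
  hA.posDef_iff_isUnit.mpr ((Matrix.isUnit_iff_isUnit_det _).mpr h.isUnit)

end Levi

/-! ### Second derivatives of real functions. -/

section SecondDerivative

variable {E : Type*} [NormedAddCommGroup E] [NormedSpace ℝ E]

theorem deriv_deriv_comp_line {f : E → ℝ} {z : E} (hf : ContDiffAt ℝ 2 f z) (v : E) :
    deriv (deriv fun t : ℝ => f (z + t • v)) 0 = fderiv ℝ (fderiv ℝ f) z v v := by
  have hline (t : ℝ) : HasDerivAt (fun t : ℝ => z + t • v) v t := by
    simpa using ((hasDerivAt_id t).smul_const v).const_add z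
  have htend : Filter.Tendsto (fun t : ℝ => z + t • v) (𝓝 0) (𝓝 z) := by
    simpa using (hline 0).continuousAt.tendsto
  have h1 : ∀ᶠ w in 𝓝 z, DifferentiableAt ℝ f w :=
    (hf.eventually (by simp)).mono fun w hw => hw.differentiableAt (by simp)
  have h2 : deriv (fun t : ℝ => f (z + t • v)) =ᶠ[𝓝 0] fun t => fderiv ℝ f (z + t • v) v :=
    (htend.eventually h1).mono fun t ht => (ht.hasFDerivAt.comp_hasDerivAt t (hline t)).deriv
  rw [h2.deriv_eq]
  have h3 : HasFDerivAt (fderiv ℝ f) (fderiv ℝ (fderiv ℝ f) z) (z + (0 : ℝ) • v) := by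
    simpa using ((hf.fderiv_right (m := 1) (by norm_num)).differentiableAt
      (by simp)).hasFDerivAt
  have h4 := (ContinuousLinearMap.apply ℝ ℝ v).hasFDerivAt.comp_hasDerivAt (0 : ℝ)
    (h3.comp_hasDerivAt (0 : ℝ) (hline 0))
  exact h4.deriv

/-- The necessary second order condition at a local maximum. -/
theorem _root_.IsLocalMax.fderiv_fderiv_nonpos {f : E → ℝ} {z : E} (h : IsLocalMax f z)
    (hf : ContDiffAt ℝ 2 f z) (v : E) : fderiv ℝ (fderiv ℝ f) z v v ≤ 0 := by
  by_contra! hpos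
  rw [← deriv_deriv_comp_line hf v] at hpos
  have hc : ContinuousAt (fun t : ℝ => z + t • v) 0 := by fun_prop
  have hmax : IsLocalMax (fun t : ℝ => f (z + t • v)) 0 := by
    have := hc.tendsto.eventually (p := fun w => f w ≤ f z) (by rw [zero_smul, add_zero]; exact h)
    simpa [IsLocalMax, IsMaxFilter] using this
  have hfc : ContinuousAt (fun t : ℝ => f (z + t • v)) 0 := by
    refine ContinuousAt.comp ?_ hc
    simpa using hf.continuousAt
  -- A positive second derivative would make the maximum a minimum as well, so the function would be
  -- locally constant along the line and its second derivative zero.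
  have hmin := isLocalMin_of_deriv_deriv_pos hpos hmax.deriv_eq_zero hfc
  have hconst : (fun t : ℝ => f (z + t • v)) =ᶠ[𝓝 0] fun _ => f (z + (0 : ℝ) • v) := by
    filter_upwards [hmax, hmin] with t h1 h2 using le_antisymm h1 h2
  have h0 : deriv (fun t : ℝ => f (z + t • v)) =ᶠ[𝓝 0] fun _ => 0 := by
    refine hconst.deriv.trans ?_
    simp
  rw [h0.deriv_eq] at hpos
  simp at hpos

theorem fderiv_fderiv_add_smul {f g : E → ℝ} {z : E} (hf : ContDiffAt ℝ 2 f z)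
    (hg : ContDiffAt ℝ 2 g z) (c : ℝ) :
    fderiv ℝ (fderiv ℝ fun w => f w + c * g w) z
      = fderiv ℝ (fderiv ℝ f) z + c • fderiv ℝ (fderiv ℝ g) z := by
  have hev {h : E → ℝ} (hh : ContDiffAt ℝ 2 h z) : ∀ᶠ w in 𝓝 z, DifferentiableAt ℝ h w :=
    (hh.eventually (by simp)).mono fun w hw => hw.differentiableAt (by simp)
  have hd {h : E → ℝ} (hh : ContDiffAt ℝ 2 h z) : DifferentiableAt ℝ (fderiv ℝ h) z :=
    (hh.fderiv_right (m := 1) (by norm_num)).differentiableAt (by simp)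
  have h1 : fderiv ℝ (fun w => f w + c * g w) =ᶠ[𝓝 z] fun w => fderiv ℝ f w + c • fderiv ℝ g w := by
    filter_upwards [hev hf, hev hg] with w hfw hgw
    exact (hfw.hasFDerivAt.add (hgw.hasFDerivAt.const_mul c)).fderiv
  rw [h1.fderiv_eq]
  exact ((hd hf).hasFDerivAt.add ((hd hg).hasFDerivAt.const_smul c)).fderiv

theorem fderiv_fderiv_neg {f : E → ℝ} {z : E} :
    fderiv ℝ (fderiv ℝ fun w => -f w) z = -fderiv ℝ (fderiv ℝ f) z := by
  have h1 : (fderiv ℝ fun w => -f w) = fun w => -fderiv ℝ f w := funext fun w => fderiv_fun_neg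
  rw [h1, fderiv_fun_neg]

theorem fderiv_fderiv_comm {f : E → ℝ} {z : E} (hf : ContDiffAt ℝ 2 f z) (v w : E) :
    fderiv ℝ (fderiv ℝ f) z v w = fderiv ℝ (fderiv ℝ f) z w v :=
  hf.isSymmSndFDerivAt (by simp) v w

end SecondDerivative

/-! ### The Gaussian barrier and its complex Hessian. -/

section Barrier

variable {n : ℕ}

/-- The real inner product of `ℂⁿ`. -/
def euclid (n : ℕ) : Cn n →L[ℝ] Cn n →L[ℝ] ℝ :=
  ∑ i, ((Complex.reCLM ∘L ContinuousLinearMap.proj i).smulRight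
      (Complex.reCLM ∘L ContinuousLinearMap.proj i)
    + (Complex.imCLM ∘L ContinuousLinearMap.proj i).smulRight
      (Complex.imCLM ∘L ContinuousLinearMap.proj i))

theorem euclid_apply (v w : Cn n) :
    euclid n v w = ∑ i, ((v i).re * (w i).re + (v i).im * (w i).im) := by
  unfold euclid
  rw [_root_.sum_apply, _root_.sum_apply]
  rfl

theorem euclid_comm (v w : Cn n) : euclid n v w = euclid n w v := by
  simp only [euclid_apply]
  exact Finset.sum_congr rfl fun i _ => by ring

theorem euclid_apply_ex (v : Cn n) (i : Fin n) : euclid n v (ex i) = (v i).re := by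
  rw [euclid_apply, Finset.sum_eq_single i] <;> simp +contextual [ex]

theorem euclid_apply_ey (v : Cn n) (i : Fin n) : euclid n v (ey i) = (v i).im := by
  rw [euclid_apply, Finset.sum_eq_single i] <;> simp +contextual [ey]

theorem euclid_self_eq_norm_sq (v : Cn n) :
    euclid n v v = ‖(WithLp.toLp 2 v : EuclideanSpace ℂ (Fin n))‖ ^ 2 := by
  rw [EuclideanSpace.norm_sq_eq, euclid_apply]
  refine Finset.sum_congr rfl fun i _ => ?_
  rw [← Complex.normSq_eq_norm_sq, Complex.normSq_apply]

theorem levi_euclid : levi (euclid n) = (1 / 2 : ℝ) • 1 := by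
  ext i j
  simp only [levi, Matrix.of_apply, euclid_apply_ex, euclid_apply_ey]
  by_cases h : i = j
  · subst h; simp [ex, ey]; norm_num
  · simp [ex, ey, h, Ne.symm h]

theorem levi_smulRight_euclid (w : Cn n) :
    levi ((euclid n w).smulRight (euclid n w)) = (1 / 4 : ℝ) • vecMulVec (star w) w := by
  ext i j
  simp only [levi, Matrix.of_apply, ContinuousLinearMap.smulRight_apply, _root_.smul_apply,
    euclid_apply_ex, euclid_apply_ey, Matrix.smul_apply, vecMulVec_apply]
  apply Complex.ext
  · simp
  · simp; ring

/-- The Gaussian barrier of the Hopf lemma. -/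
def barrier (α : ℝ) (q z : Cn n) : ℝ := Real.exp (-α * euclid n (z - q) (z - q))

theorem contDiff_barrier (α : ℝ) (q : Cn n) : ContDiff ℝ 2 (barrier α q) := by
  unfold barrier
  fun_prop

theorem hasFDerivAt_barrier (α : ℝ) (q z : Cn n) :
    HasFDerivAt (barrier α q) ((-2 * α * barrier α q z) • euclid n (z - q)) z := by
  have h1 : HasFDerivAt (fun z => z - q) (ContinuousLinearMap.id ℝ (Cn n)) z :=
    (hasFDerivAt_id z).sub_const q
  have h2 := (((euclid n).hasFDerivAt.comp z h1).clm_apply h1).const_mul (-α)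
  refine h2.exp.congr_fderiv ?_
  ext v
  have h3 : (euclid n v) (z - q) = euclid n (z - q) v := euclid_comm _ _
  simp only [_root_.smul_apply, _root_.add_apply, ContinuousLinearMap.comp_apply,
    ContinuousLinearMap.flip_apply, ContinuousLinearMap.id_apply, Function.comp_apply,
    smul_eq_mul, barrier, h3]
  ring

theorem fderiv_fderiv_barrier (α : ℝ) (q z : Cn n) :
    fderiv ℝ (fderiv ℝ (barrier α q)) z
      = barrier α q z • ((4 * α ^ 2) • (euclid n (z - q)).smulRight (euclid n (z - q))
        - (2 * α) • euclid n) := by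
  have h0 : fderiv ℝ (barrier α q) = fun z => (-2 * α * barrier α q z) • euclid n (z - q) :=
    funext fun z => (hasFDerivAt_barrier α q z).fderiv
  have h1 : HasFDerivAt (fun z => z - q) (ContinuousLinearMap.id ℝ (Cn n)) z :=
    (hasFDerivAt_id z).sub_const q
  have h2 := ((hasFDerivAt_barrier α q z).const_mul (-2 * α)).smul
    ((euclid n).hasFDerivAt.comp z h1)
  rw [h0]
  refine h2.fderiv.trans ?_
  ext v w
  simp
  ring

/-- Relative to the common factor, the nonnegative rank-one term grows with `α` while the negative
term does not: for large `α` the barrier is a strict subsolution on compact sets avoiding `q`. -/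
theorem levi_fderiv_fderiv_barrier (α : ℝ) (q z : Cn n) :
    levi (fderiv ℝ (fderiv ℝ (barrier α q)) z)
      = (barrier α q z * α) • (α • vecMulVec (star (z - q)) (z - q) - 1) := by
  rw [fderiv_fderiv_barrier, levi_smul, levi_sub, levi_smul, levi_smul, levi_euclid,
    levi_smulRight_euclid, smul_smul, smul_smul]
  match_scalars <;> ring

end Barrier

/-! ### Interior touching balls. -/

section Touching

/-- A boundary point of an open set `V` can be moved to one at which `V` has an interior ball. -/
theorem exists_touching_ball {E : Type*} [NormedAddCommGroup E] [NormedSpace ℝ E]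
    [StrictConvexSpace ℝ E] [ProperSpace E] {U V : Set E} (hU : IsOpen U) (hV : IsOpen V)
    {p : E} (hpU : p ∈ U) (hpV : p ∉ V) (hcl : p ∈ closure V) :
    ∃ p' ∈ U \ V, ∃ q ≠ p', ∀ z, dist z q ≤ dist p' q → z ≠ p' → z ∈ U ∩ V := by
  obtain ⟨ε, hε, hball⟩ := Metric.nhds_basis_closedBall.mem_iff.mp (hU.mem_nhds hpU)
  -- Taking `q₀` within `ε / 2` keeps the ball about `q₀` reaching to the nearest point outside `V`
  -- inside `closedBall p ε`.
  obtain ⟨q₀, hq₀V, hq₀⟩ := Metric.mem_closure_iff.mp hcl (ε / 2) (by positivity)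
  have hK : IsCompact (Metric.closedBall p ε \ V) := (isCompact_closedBall p ε).diff hV
  have hpK : p ∈ Metric.closedBall p ε \ V := ⟨Metric.mem_closedBall_self hε.le, hpV⟩
  obtain ⟨p', hp', hd⟩ := hK.exists_infDist_eq_dist ⟨p, hpK⟩ q₀
  have hle (z) (hz : z ∈ Metric.closedBall p ε \ V) : dist q₀ p' ≤ dist q₀ z :=
    hd ▸ Metric.infDist_le_dist_of_mem hz
  have hne : q₀ ≠ p' := fun h => hp'.2 (h ▸ hq₀V)
  have h1 : dist q₀ (midpoint ℝ q₀ p') = dist q₀ p' / 2 := by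
    rw [dist_left_midpoint]; norm_num; ring
  have h2 : dist (midpoint ℝ q₀ p') p' = dist q₀ p' / 2 := by
    rw [dist_midpoint_right]; norm_num; ring
  -- The ball about `q₀` may meet the complement of `V` at several points. The ball of half the
  -- radius centred at the midpoint touches its sphere at `p'` alone.
  refine ⟨p', ⟨hball hp'.1, hp'.2⟩, midpoint ℝ q₀ p', ?_, fun z hz hzp => ?_⟩
  · intro h
    rw [h, dist_self] at h2
    have := dist_pos.mpr hne
    linarith
  · rw [dist_comm p', h2, dist_comm] at hz
    have h3 : dist q₀ z ≤ dist q₀ p' := by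
      linarith [dist_triangle q₀ (midpoint ℝ q₀ p') z]
    have hzball : z ∈ Metric.closedBall p ε := by
      rw [Metric.mem_closedBall, dist_comm]
      linarith [dist_triangle p q₀ z, hle p hpK, dist_comm q₀ p]
    refine ⟨hball hzball, by_contra fun hzV => hzp ?_⟩
    have h4 := hle z ⟨hzball, hzV⟩
    have h5 : dist (midpoint ℝ q₀ p') z = dist q₀ p' / 2 := by
      linarith [dist_triangle q₀ (midpoint ℝ q₀ p') z]
    have h6 : dist q₀ z = dist q₀ p' := le_antisymm h3 h4
    -- Equality holds in the triangle inequality, so by strict convexity the centre is the midpoint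
    -- of `q₀` and `z` too.
    have h7 : midpoint ℝ q₀ z = midpoint ℝ q₀ p' := by
      refine (eq_midpoint_of_dist_eq_half ?_ ?_).symm
      · rw [h1, h6]
      · rw [h5, h6]
    have h8 := (midpoint_eq_midpoint_iff_vsub_eq_vsub ℝ).mp h7
    rw [vsub_self] at h8
    exact (sub_eq_zero.mp h8.symm).symm

end Touching

/-! ### The Hopf lemma and the strong maximum principle. -/

section MaximumPrinciple

variable {n : ℕ}

/-- The norm of `Cn n` is the sup norm, which is not strictly convex in general, so the touching
ball is found in `EuclideanSpace` and transported back. -/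
theorem exists_euclid_touching_ball {U V : Set (Cn n)} (hU : IsOpen U) (hV : IsOpen V)
    {p : Cn n} (hpU : p ∈ U) (hpV : p ∉ V) (hcl : p ∈ closure V) :
    ∃ p' ∈ U \ V, ∃ q ≠ p', ∀ z,
      euclid n (z - q) (z - q) ≤ euclid n (p' - q) (p' - q) → z ≠ p' → z ∈ U ∩ V := by
  let e : EuclideanSpace ℂ (Fin n) ≃ₜ Cn n := (EuclideanSpace.equiv (Fin n) ℂ).toHomeomorph
  let _ : InnerProductSpace ℝ (EuclideanSpace ℂ (Fin n)) := InnerProductSpace.rclikeToReal ℂ _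
  obtain ⟨p', hp', q, hq, h⟩ := exists_touching_ball (hU.preimage e.continuous)
    (hV.preimage e.continuous) (p := e.symm p) (by simpa using hpU) (by simpa using hpV)
    (by rw [← e.preimage_closure]; simpa using hcl)
  refine ⟨e p', hp', e q, e.injective.ne hq, fun z hz hzp => ?_⟩
  have := h (e.symm z) ?_ fun h0 => hzp (by simp [← h0])
  · simpa using this
  rw [euclid_self_eq_norm_sq, euclid_self_eq_norm_sq] at hz
  rw [dist_eq_norm, dist_eq_norm]
  exact (sq_le_sq₀ (norm_nonneg _) (norm_nonneg _)).mp hz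

theorem posSemidef_neg_levi_of_isLocalMax {f : Cn n → ℝ} {z : Cn n} (h : IsLocalMax f z)
    (hf : ContDiffAt ℝ 2 f z) : (-levi (fderiv ℝ (fderiv ℝ f) z)).PosSemidef := by
  rw [← levi_neg, posSemidef_levi_iff]
  · intro v
    have h1 := h.fderiv_fderiv_nonpos hf v
    have h2 := h.fderiv_fderiv_nonpos hf (Complex.I • v)
    simp only [_root_.neg_apply]
    linarith
  · intro v w
    simp only [_root_.neg_apply, fderiv_fderiv_comm hf v w]

theorem trace_mul_vecMulVec_star_pos {P : Matrix (Fin n) (Fin n) ℂ} (hP : P.PosDef) {w : Cn n}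
    (hw : w ≠ 0) : 0 < (P * vecMulVec (star w) w).trace.re := by
  rw [mul_vecMulVec, trace_vecMulVec, dotProduct_comm]
  have := hP.dotProduct_mulVec_pos (x := star w) (by simpa using hw)
  rw [star_star] at this
  exact (Complex.pos_iff.mp this).1

theorem exists_forall_trace_mul_barrier_pos {K : Set (Cn n)} (hK : IsCompact K)
    {P : Cn n → Matrix (Fin n) (Fin n) ℂ} (hP : ContinuousOn P K) (hPpos : ∀ z ∈ K, (P z).PosDef)
    {q : Cn n} (hq : q ∉ K) :
    ∃ α > 0, ∀ z ∈ K, 0 < (P z * levi (fderiv ℝ (fderiv ℝ (barrier α q)) z)).trace.re := by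
  have hpos : ∀ z ∈ K, 0 < (P z * vecMulVec (star (z - q)) (z - q)).trace.re := fun z hz =>
    trace_mul_vecMulVec_star_pos (hPpos z hz) (sub_ne_zero.mpr fun h => hq (h ▸ hz))
  have hcP : ContinuousOn (fun z => (P z).trace.re) K :=
    (Complex.continuous_re.comp (continuous_id.matrix_trace)).comp_continuousOn hP
  have hw : Continuous fun z : Cn n => vecMulVec (star (z - q)) (z - q) :=
    Continuous.matrix_vecMulVec (by fun_prop) (by fun_prop)
  have hmul : ContinuousOn (fun z => P z * vecMulVec (star (z - q)) (z - q)) K :=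
    (continuous_fst.matrix_mul continuous_snd).comp_continuousOn (hP.prodMk hw.continuousOn)
  have hcQ : ContinuousOn (fun z => (P z * vecMulVec (star (z - q)) (z - q)).trace.re) K :=
    (Complex.continuous_re.comp (continuous_id.matrix_trace)).comp_continuousOn hmul
  -- `α` bounds the quotient of the two competing traces on `K`; `|α| + 1` then makes the inequality
  -- strict and the parameter positive.
  obtain ⟨α, hα⟩ := (hK.image_of_continuousOn
    (hcP.div hcQ fun z hz => (hpos z hz).ne')).bddAbove
  refine ⟨|α| + 1, by positivity, fun z hz => ?_⟩
  have h1 := hα ⟨z, hz, rfl⟩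
  simp only [Pi.div_apply, div_le_iff₀ (hpos z hz)] at h1
  have h2 : (P z).trace.re < (|α| + 1) * (P z * vecMulVec (star (z - q)) (z - q)).trace.re :=
    h1.trans_lt (mul_lt_mul_of_pos_right (by linarith [le_abs_self α]) (hpos z hz))
  rw [levi_fderiv_fderiv_barrier, Matrix.mul_smul, Matrix.mul_sub, Matrix.mul_smul, trace_smul,
    trace_sub, trace_smul, Complex.smul_re, Complex.sub_re, Complex.smul_re, mul_one]
  have h3 : 0 < barrier (|α| + 1) q z := Real.exp_pos _
  simp only [smul_eq_mul]
  exact mul_pos (by positivity) (sub_pos.mpr h2)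

/-- The Hopf lemma. -/
theorem not_isMax_of_touching_ball {U : Set (Cn n)} (hU : IsOpen U) {u : Cn n → ℝ}
    (hu : ContDiffOn ℝ 2 u U) {P : Cn n → Matrix (Fin n) (Fin n) ℂ} (hP : ContinuousOn P U)
    (hPpos : ∀ z ∈ U, (P z).PosDef)
    (hsub : ∀ z ∈ U, 0 ≤ (P z * levi (fderiv ℝ (fderiv ℝ u) z)).trace.re)
    {p q : Cn n} (hle : ∀ z ∈ U, u z ≤ u p) (hp : p ∈ U) (hqp : q ≠ p)
    (hball : ∀ z, euclid n (z - q) (z - q) ≤ euclid n (p - q) (p - q) → z ≠ p → u z < u p) :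
    False := by
  obtain ⟨r, hr, hrU⟩ := Metric.nhds_basis_closedBall.mem_iff.mp
    ((hU.inter (isOpen_compl_singleton (x := q))).mem_nhds ⟨hp, hqp.symm⟩)
  have hKU : Metric.closedBall p r ⊆ U := fun z hz => (hrU hz).1
  have hK := isCompact_closedBall p r
  obtain ⟨α, hα, hbar⟩ := exists_forall_trace_mul_barrier_pos hK (hP.mono hKU)
    (fun z hz => hPpos z (hKU hz)) (q := q) fun hq => (hrU hq).2 rfl
  have hN : Continuous fun z : Cn n => euclid n (z - q) (z - q) := by fun_prop
  -- On the part of the small sphere lying in the touching ball, `u` is below `u p` by a uniform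
  -- `ε`.
  have hK' : IsCompact (Metric.sphere p r ∩
      {z | euclid n (z - q) (z - q) ≤ euclid n (p - q) (p - q)}) :=
    (isCompact_sphere p r).inter_right (isClosed_le hN continuous_const)
  obtain ⟨ε, hε, hεle⟩ := hK'.exists_forall_le' (f := fun z => u p - u z) (a := 0)
    (continuousOn_const.sub (hu.continuousOn.mono fun z hz =>
      hKU (Metric.sphere_subset_closedBall hz.1)))
    fun z hz => sub_pos.mpr (hball z hz.2 fun h => by
      have := hz.1
      rw [h, Metric.mem_sphere, dist_self] at this
      exact hr.ne this)
  obtain ⟨z, hz, hmax⟩ := hK.exists_isMaxOn ⟨p, Metric.mem_closedBall_self hr.le⟩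
    (f := fun z => u z + ε * barrier α q z)
    ((hu.continuousOn.mono hKU).add
      (continuous_const.mul (contDiff_barrier α q).continuous).continuousOn)
  have hzp : u p + ε * barrier α q p ≤ u z + ε * barrier α q z :=
    hmax (Metric.mem_closedBall_self hr.le)
  have hbp : 0 < barrier α q p := Real.exp_pos _
  -- The maximum of `u + ε * barrier` is interior: on the sphere, either `u` drops by `ε` and the
  -- barrier is at most one, or the point is farther from `q` than `p` and the barrier is below its
  -- value at `p`.
  have hint : z ∈ Metric.ball p r := by
    rw [← Metric.closedBall_sdiff_sphere]
    refine ⟨hz, fun hs => ?_⟩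
    rcases le_or_gt (euclid n (z - q) (z - q)) (euclid n (p - q) (p - q)) with h | h
    · have h1 := hεle z ⟨hs, h⟩
      have h2 : barrier α q z ≤ 1 := by
        refine Real.exp_le_one_iff.mpr ?_
        rw [euclid_self_eq_norm_sq]
        nlinarith [sq_nonneg ‖(WithLp.toLp 2 (z - q) : EuclideanSpace ℂ (Fin n))‖]
      nlinarith [mul_pos hε hbp, mul_le_mul_of_nonneg_left h2 hε.le]
    · have h1 : barrier α q z < barrier α q p := by
        refine Real.exp_lt_exp.mpr ?_
        nlinarith
      nlinarith [hle z (hKU hz), mul_lt_mul_of_pos_left h1 hε]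
  have hloc := hmax.isLocalMax
    (Filter.mem_of_superset (Metric.isOpen_ball.mem_nhds hint) Metric.ball_subset_closedBall)
  have huz : ContDiffAt ℝ 2 u z := hu.contDiffAt (hU.mem_nhds (hKU hz))
  have hbz : ContDiffAt ℝ 2 (barrier α q) z := (contDiff_barrier α q).contDiffAt
  -- At this interior maximum the trace of `P` against the Levi matrix is nonpositive, yet `u`
  -- contributes a nonnegative amount and the barrier a positive one.
  have h1 := posSemidef_neg_levi_of_isLocalMax hloc (huz.add (contDiffAt_const.mul hbz))
  have h2 := (Complex.nonneg_iff.mp (trace_mul_nonneg (hPpos z (hKU hz)) h1)).1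
  rw [fderiv_fderiv_add_smul huz hbz, levi_add, levi_smul, Matrix.mul_neg, Matrix.mul_add,
    Matrix.mul_smul, trace_neg, trace_add, trace_smul, Complex.neg_re, Complex.add_re,
    Complex.smul_re, smul_eq_mul] at h2
  nlinarith [mul_pos hε (hbar z hz), hsub z (hKU hz)]

/-- The strong maximum principle for subsolutions of `tr (P · ∂∂̄u) = 0`. -/
theorem eventually_eq_of_isMax {U : Set (Cn n)} (hU : IsOpen U) {u : Cn n → ℝ}
    (hu : ContDiffOn ℝ 2 u U) {P : Cn n → Matrix (Fin n) (Fin n) ℂ} (hP : ContinuousOn P U)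
    (hPpos : ∀ z ∈ U, (P z).PosDef)
    (hsub : ∀ z ∈ U, 0 ≤ (P z * levi (fderiv ℝ (fderiv ℝ u) z)).trace.re)
    {p : Cn n} (hle : ∀ z ∈ U, u z ≤ u p) (hp : p ∈ U) : ∀ᶠ z in 𝓝 p, u z = u p := by
  by_contra hcon
  have hV : IsOpen (U ∩ u ⁻¹' Set.Iio (u p)) :=
    hu.continuousOn.isOpen_inter_preimage hU isOpen_Iio
  have hcl : p ∈ closure (U ∩ u ⁻¹' Set.Iio (u p)) := by
    rw [mem_closure_iff_frequently]
    refine ((Filter.not_eventually.mp hcon).and_eventually (hU.mem_nhds hp)).mono ?_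
    rintro z ⟨hz, hzU⟩
    exact ⟨hzU, lt_of_le_of_ne (hle z hzU) hz⟩
  obtain ⟨p', ⟨hp'U, hp'V⟩, q, hq, hball⟩ :=
    exists_euclid_touching_ball hU hV hp (fun h => lt_irrefl (u p) h.2) hcl
  have heq : u p' = u p := (hle p' hp'U).antisymm (not_lt.mp fun h => hp'V ⟨hp'U, h⟩)
  refine not_isMax_of_touching_ball hU hu hP hPpos hsub (p := p') (fun z hz => heq ▸ hle z hz)
    hp'U hq fun z hz hzp => heq ▸ (hball z hz hzp).2.2

end MaximumPrinciple

/-! ### The metric and the complex Hessian in charts. -/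

section Charts

variable {n : ℕ}

theorem fderiv_ofReal_comp {f : Cn n → ℝ} {z : Cn n} (hf : DifferentiableAt ℝ f z) (v : Cn n) :
    fderiv ℝ (fun w => (f w : ℂ)) z v = (fderiv ℝ f z v : ℝ) := by
  exact congrArg (fun L => L v) (Complex.ofRealCLM.hasFDerivAt.comp z hf.hasFDerivAt).fderiv

theorem dz_dzbar_ofReal {f : Cn n → ℝ} {z : Cn n} (hf : ContDiffAt ℝ 2 f z) (i j : Fin n) :
    dz i (dzbar j fun w => (f w : ℂ)) z = levi (fderiv ℝ (fderiv ℝ f) z) i j := by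
  have h1 : ∀ᶠ w in 𝓝 z, DifferentiableAt ℝ f w :=
    (hf.eventually (by simp)).mono fun w hw => hw.differentiableAt (by simp)
  have h2 : DifferentiableAt ℝ (fderiv ℝ f) z :=
    (hf.fderiv_right (m := 1) (by norm_num)).differentiableAt (by simp)
  have h3 : dzbar j (fun w => (f w : ℂ)) =ᶠ[𝓝 z] fun w =>
      (1 / 2 : ℂ) * ((fderiv ℝ f w (ex j) : ℝ) + Complex.I * (fderiv ℝ f w (ey j) : ℝ)) := by
    filter_upwards [h1] with w hw
    simp only [dzbar, fderiv_ofReal_comp hw]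
  have h4 (u : Cn n) : HasFDerivAt (fun w => ((fderiv ℝ f w u : ℝ) : ℂ))
      (Complex.ofRealCLM ∘L ((ContinuousLinearMap.apply ℝ ℝ u) ∘L fderiv ℝ (fderiv ℝ f) z)) z :=
    Complex.ofRealCLM.hasFDerivAt.comp z
      ((ContinuousLinearMap.apply ℝ ℝ u).hasFDerivAt.comp z h2.hasFDerivAt)
  have h5 := ((h4 (ex j)).add ((h4 (ey j)).const_mul Complex.I)).const_mul (1 / 2 : ℂ)
  have h6 := h5.fderiv
  simp only [dz, h3.fderiv_eq, levi, Matrix.of_apply]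
  rw [show (fun w => (1 / 2 : ℂ) * ((fderiv ℝ f w (ex j) : ℝ)
      + Complex.I * (fderiv ℝ f w (ey j) : ℝ))) = fun w => (1 / 2 : ℂ) * (((fun w =>
      ((fderiv ℝ f w (ex j) : ℝ) : ℂ)) + fun w => Complex.I * ((fderiv ℝ f w (ey j) : ℝ) : ℂ)) w)
    from rfl, h6]
  simp only [_root_.smul_apply, _root_.add_apply, ContinuousLinearMap.comp_apply,
    ContinuousLinearMap.apply_apply, Complex.ofRealCLM_apply, smul_eq_mul]
  linear_combination (1 / 4 * ((fderiv ℝ (fderiv ℝ f) z) (ey i) (ex j) : ℂ) * 0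
    - 1 / 4 * ((fderiv ℝ (fderiv ℝ f) z) (ey i) (ey j) : ℂ)) * Complex.I_sq

theorem complexHessian_eq_levi {X : Type*} [TopologicalSpace X] {φ : X → ℝ}
    {e : OpenPartialHomeomorph X (Cn n)} {z : Cn n} (h : ContDiffAt ℝ 2 (φ ∘ e.symm) z) :
    complexHessian φ e z = levi (fderiv ℝ (fderiv ℝ (φ ∘ e.symm)) z) := by
  ext i j
  exact dz_dzbar_ofReal h i j

variable {M : Type*} [TopologicalSpace M] [ChartedSpace (Cn n) M]
  [IsManifold 𝓘(ℂ, Cn n) ω M]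

theorem contDiffOn_comp_symm {φ : M → ℝ} {k : ℕ∞ω} (hφ : ContMDiff 𝓘(ℝ, Cn n) 𝓘(ℝ, ℝ) k φ)
    {e : OpenPartialHomeomorph M (Cn n)} (he : e ∈ atlas (Cn n) M) :
    ContDiffOn ℝ k (φ ∘ e.symm) e.target := by
  rw [← contMDiffOn_iff_contDiffOn]
  exact hφ.comp_contMDiffOn
    (contMDiffOn_symm_of_mem_maximalAtlas (IsManifold.subset_maximalAtlas he))

theorem mdifferentiable_atlas {e : OpenPartialHomeomorph M (Cn n)} (he : e ∈ atlas (Cn n) M) :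
    e.MDifferentiable 𝓘(ℝ, Cn n) 𝓘(ℝ, Cn n) :=
  mdifferentiable_of_mem_atlas he

theorem mfderiv_symm_apply_ne_zero {e : OpenPartialHomeomorph M (Cn n)} (he : e ∈ atlas (Cn n) M)
    {z : Cn n} (hz : z ∈ e.target) {v : Cn n} (hv : v ≠ 0) :
    (mfderiv 𝓘(ℝ, Cn n) 𝓘(ℝ, Cn n) e.symm z : Cn n →L[ℝ] Cn n) v ≠ 0 := by
  have h := (mdifferentiable_atlas he).comp_symm_deriv hz
  let D : Cn n →L[ℝ] Cn n := mfderiv 𝓘(ℝ, Cn n) 𝓘(ℝ, Cn n) e.symm z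
  let D' : Cn n →L[ℝ] Cn n := mfderiv 𝓘(ℝ, Cn n) 𝓘(ℝ, Cn n) e (e.symm z)
  have h1 : D' (D v) = v := congrArg (fun L : Cn n →L[ℝ] Cn n => L v) h
  intro h0
  have h2 : D v = 0 := h0
  rw [h2, map_zero] at h1
  exact hv h1.symm

/-- The transition map between two holomorphic charts. -/
theorem contDiffOn_transition {e e' : OpenPartialHomeomorph M (Cn n)} (he : e ∈ atlas (Cn n) M)
    (he' : e' ∈ atlas (Cn n) M) : ContDiffOn ℂ ω (e ∘ e'.symm) (e'.symm.trans e).source := by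
  have h := (contDiffGroupoid ω 𝓘(ℂ, Cn n)).compatible he' he
  rw [contDiffGroupoid, mem_groupoid_of_pregroupoid] at h
  have h1 : ContDiffOn ℂ ω _ _ := h.1
  simpa using h1

namespace HermitianMetric

variable (g : HermitianMetric n M)

/-- The Riemannian metric in a chart `e`, as a bilinear form. -/
def metricForm (e : OpenPartialHomeomorph M (Cn n)) (z : Cn n) : Cn n →L[ℝ] Cn n →L[ℝ] ℝ :=
  let D : Cn n →L[ℝ] Cn n := mfderiv 𝓘(ℝ, Cn n) 𝓘(ℝ, Cn n) e.symm z
  let B : Cn n →L[ℝ] Cn n →L[ℝ] ℝ := g.inner (e.symm z)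
  B.bilinearComp D D

theorem metricForm_apply (e : OpenPartialHomeomorph M (Cn n)) (z v w : Cn n) :
    g.metricForm e z v w = g.localMetric e z v w := rfl

theorem coeff_eq_levi (e : OpenPartialHomeomorph M (Cn n)) (z : Cn n) :
    g.coeff e z = levi (g.metricForm e z) := rfl

theorem metricForm_comm (e : OpenPartialHomeomorph M (Cn n)) (z v w : Cn n) :
    g.metricForm e z v w = g.metricForm e z w v := g.symm _ _ _

theorem metricForm_pos {e : OpenPartialHomeomorph M (Cn n)} (he : e ∈ atlas (Cn n) M)
    {z : Cn n} (hz : z ∈ e.target) {v : Cn n} (hv : v ≠ 0) : 0 < g.metricForm e z v v :=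
  g.pos _ _ (mfderiv_symm_apply_ne_zero he hz hv)

/-- This is the tangent map of `e.symm` applied to a constant vector field; it supplies the
continuity of the metric coefficients. -/
theorem contMDiffOn_mfderiv_symm_apply {e : OpenPartialHomeomorph M (Cn n)}
    (he : e ∈ atlas (Cn n) M) (v : Cn n) :
    ContMDiffOn 𝓘(ℝ, Cn n) 𝓘(ℝ, Cn n).tangent 0
      (fun z => (⟨e.symm z, mfderiv 𝓘(ℝ, Cn n) 𝓘(ℝ, Cn n) e.symm z v⟩ :
        TangentBundle 𝓘(ℝ, Cn n) M)) e.target := by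
  have h1 : ContMDiffOn 𝓘(ℝ, Cn n) 𝓘(ℝ, Cn n) 1 e.symm e.target :=
    contMDiffOn_symm_of_mem_maximalAtlas (IsManifold.subset_maximalAtlas he)
  have h2 := h1.contMDiffOn_tangentMapWithin (m := 0) (by norm_num) e.open_target.uniqueMDiffOn
  have h3 : ContMDiffOn 𝓘(ℝ, Cn n) 𝓘(ℝ, Cn n).tangent 0
      (fun z : Cn n => (⟨z, v⟩ : TangentBundle 𝓘(ℝ, Cn n) (Cn n))) e.target :=
    contMDiffOn_vectorSpace_iff_contDiffOn.mpr contDiffOn_const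
  refine (h2.comp h3 fun z hz => hz).congr fun z hz => ?_
  simp only [Function.comp_apply, tangentMapWithin,
    mfderivWithin_of_isOpen e.open_target hz]

theorem continuousOn_localMetric {e : OpenPartialHomeomorph M (Cn n)} (he : e ∈ atlas (Cn n) M)
    (v w : Cn n) : ContinuousOn (fun z => g.localMetric e z v w) e.target := by
  intro z hz
  have h1 : ContMDiffOn 𝓘(ℝ, Cn n) 𝓘(ℝ, Cn n) 0 e.symm e.target :=
    contMDiffOn_symm_of_mem_maximalAtlas (IsManifold.subset_maximalAtlas he)
  have h2 : ContMDiffWithinAt 𝓘(ℝ, Cn n) (𝓘(ℝ, Cn n).prod 𝓘(ℝ)) 0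
      (fun z => Bundle.TotalSpace.mk' ℝ (E := Bundle.Trivial M ℝ) (e.symm z)
        (g.inner (e.symm z) (mfderiv 𝓘(ℝ, Cn n) 𝓘(ℝ, Cn n) e.symm z v)
          (mfderiv 𝓘(ℝ, Cn n) 𝓘(ℝ, Cn n) e.symm z w))) e.target z := by
    apply ContMDiffWithinAt.clm_bundle_apply₂ (F₁ := Cn n) (F₂ := Cn n)
    · exact ContMDiffAt.comp_contMDiffWithinAt z (g.contMDiff.of_le zero_le).contMDiffAt
        (h1 z hz)
    · exact contMDiffOn_mfderiv_symm_apply he v z hz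
    · exact contMDiffOn_mfderiv_symm_apply he w z hz
  simp only [Bundle.contMDiffWithinAt_totalSpace] at h2
  exact h2.2.continuousWithinAt

/-- The bilinear form `g + D²φ` in a chart `e`, whose Hermitian matrix is
`g_{ij̄} + ∂²φ/∂zⁱ∂z̄ʲ`. -/
def potentialForm (φ : M → ℝ) (e : OpenPartialHomeomorph M (Cn n)) (z : Cn n) :
    Cn n →L[ℝ] Cn n →L[ℝ] ℝ :=
  g.metricForm e z + fderiv ℝ (fderiv ℝ (φ ∘ e.symm)) z

theorem contDiffAt_comp_symm {φ : M → ℝ} (hφ : ContMDiff 𝓘(ℝ, Cn n) 𝓘(ℝ, ℝ) 2 φ)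
    {e : OpenPartialHomeomorph M (Cn n)} (he : e ∈ atlas (Cn n) M)
    {z : Cn n} (hz : z ∈ e.target) : ContDiffAt ℝ 2 (φ ∘ e.symm) z :=
  (contDiffOn_comp_symm hφ he).contDiffAt (e.open_target.mem_nhds hz)

theorem levi_potentialForm {φ : M → ℝ} (hφ : ContMDiff 𝓘(ℝ, Cn n) 𝓘(ℝ, ℝ) 2 φ)
    {e : OpenPartialHomeomorph M (Cn n)} (he : e ∈ atlas (Cn n) M)
    {z : Cn n} (hz : z ∈ e.target) :
    levi (g.potentialForm φ e z) = g.coeff e z + complexHessian φ e z := by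
  rw [potentialForm, levi_add, coeff_eq_levi,
    complexHessian_eq_levi (contDiffAt_comp_symm hφ he hz)]

theorem potentialForm_comm {φ : M → ℝ} (hφ : ContMDiff 𝓘(ℝ, Cn n) 𝓘(ℝ, ℝ) 2 φ)
    {e : OpenPartialHomeomorph M (Cn n)} (he : e ∈ atlas (Cn n) M)
    {z : Cn n} (hz : z ∈ e.target) (v w : Cn n) :
    g.potentialForm φ e z v w = g.potentialForm φ e z w v := by
  simp only [potentialForm, _root_.add_apply, g.metricForm_comm e z v w,
    fderiv_fderiv_comm (contDiffAt_comp_symm hφ he hz) v w]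

theorem continuousOn_potentialForm {φ : M → ℝ} (hφ : ContMDiff 𝓘(ℝ, Cn n) 𝓘(ℝ, ℝ) 2 φ)
    {e : OpenPartialHomeomorph M (Cn n)} (he : e ∈ atlas (Cn n) M) :
    ContinuousOn (g.potentialForm φ e) e.target := by
  have h1 := (contDiffOn_comp_symm hφ he).fderiv_of_isOpen (m := 1) e.open_target (by norm_num)
  have h2 := h1.continuousOn_fderiv_of_isOpen e.open_target le_rfl
  refine continuousOn_clm_apply.mpr fun v => continuousOn_clm_apply.mpr fun w => ?_
  exact (g.continuousOn_localMetric he v w).add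
    (continuousOn_clm_apply.mp (continuousOn_clm_apply.mp h2 v) w)

end HermitianMetric

end Charts

/-! ### Invariance under holomorphic changes of chart. -/

section ChangeOfCoordinates

variable {n : ℕ}

theorem fderiv_real_smul_I {τ : Cn n → Cn n} {z : Cn n} (hτ : DifferentiableAt ℂ τ z) (v : Cn n) :
    fderiv ℝ τ z (Complex.I • v) = Complex.I • fderiv ℝ τ z v := by
  rw [hτ.fderiv_restrictScalars ℝ]
  exact (fderiv ℂ τ z).map_smul Complex.I v

/-- The second derivative of a holomorphic map is complex bilinear, and `i² = -1`. Hence the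
second-order term of the chain rule cancels between `v` and `Complex.I • v`. -/
theorem fderiv_fderiv_smul_I_smul_I {τ : Cn n → Cn n} {z : Cn n} (hτ : ContDiffAt ℂ 2 τ z)
    (v : Cn n) :
    fderiv ℝ (fderiv ℝ τ) z (Complex.I • v) (Complex.I • v) = -fderiv ℝ (fderiv ℝ τ) z v v := by
  have hτr : ContDiffAt ℝ 2 τ z := hτ.restrict_scalars ℝ
  have hsymm : IsSymmSndFDerivAt ℝ τ z := hτr.isSymmSndFDerivAt (by simp)
  have hd : HasFDerivAt (fderiv ℝ τ) (fderiv ℝ (fderiv ℝ τ) z) z :=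
    ((hτr.fderiv_right (m := 1) (by norm_num)).differentiableAt (by simp)).hasFDerivAt
  have happ (w : Cn n) : HasFDerivAt (fun y => fderiv ℝ τ y w)
      ((ContinuousLinearMap.apply ℝ (Cn n) w) ∘L fderiv ℝ (fderiv ℝ τ) z) z :=
    (ContinuousLinearMap.apply ℝ (Cn n) w).hasFDerivAt.comp z hd
  have hI (u w : Cn n) : fderiv ℝ (fderiv ℝ τ) z u (Complex.I • w)
      = Complex.I • fderiv ℝ (fderiv ℝ τ) z u w := by
    have h1 : (fun y => fderiv ℝ τ y (Complex.I • w)) =ᶠ[𝓝 z]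
        fun y => Complex.I • fderiv ℝ τ y w :=
      (hτ.eventually (by simp)).mono fun y hy =>
        fderiv_real_smul_I (hy.differentiableAt (by simp)) w
    have h2 := (happ (Complex.I • w)).unique
      (((happ w).const_smul Complex.I).congr_of_eventuallyEq h1)
    exact congrArg (fun L => L u) h2
  rw [hI, hsymm, hI, smul_smul, Complex.I_mul_I, neg_one_smul]

theorem fderiv_fderiv_comp_apply_self {f : Cn n → ℝ} {τ : Cn n → Cn n} {z : Cn n}
    (hf : ContDiffAt ℝ 2 f (τ z)) (hτ : ContDiffAt ℝ 2 τ z) (v : Cn n) :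
    fderiv ℝ (fderiv ℝ (f ∘ τ)) z v v
      = fderiv ℝ (fderiv ℝ f) (τ z) (fderiv ℝ τ z v) (fderiv ℝ τ z v)
        + fderiv ℝ f (τ z) (fderiv ℝ (fderiv ℝ τ) z v v) := by
  have hdτ : HasFDerivAt (fderiv ℝ τ) (fderiv ℝ (fderiv ℝ τ) z) z :=
    ((hτ.fderiv_right (m := 1) (by norm_num)).differentiableAt (by simp)).hasFDerivAt
  have hdf : HasFDerivAt (fderiv ℝ f) (fderiv ℝ (fderiv ℝ f) (τ z)) (τ z) :=
    ((hf.fderiv_right (m := 1) (by norm_num)).differentiableAt (by simp)).hasFDerivAt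
  have hτz : HasFDerivAt τ (fderiv ℝ τ z) z := (hτ.differentiableAt (by simp)).hasFDerivAt
  have h1 : (fun y => fderiv ℝ (f ∘ τ) y v) =ᶠ[𝓝 z]
      fun y => fderiv ℝ f (τ y) (fderiv ℝ τ y v) := by
    filter_upwards [hτ.eventually (by simp),
      hτ.continuousAt.eventually (hf.eventually (by simp))] with y hy hfy
    exact congrArg (fun L => L v) ((hfy.differentiableAt (by simp)).hasFDerivAt.comp y
      (hy.differentiableAt (by simp)).hasFDerivAt).fderiv
  have hcomp : HasFDerivAt (fderiv ℝ (f ∘ τ)) (fderiv ℝ (fderiv ℝ (f ∘ τ)) z) z :=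
    (((hf.comp z hτ).fderiv_right (m := 1) (by norm_num)).differentiableAt (by simp)).hasFDerivAt
  have h2 := (ContinuousLinearMap.apply ℝ ℝ v).hasFDerivAt.comp z hcomp
  have h3 := (hdf.comp z hτz).clm_apply
    ((ContinuousLinearMap.apply ℝ (Cn n) v).hasFDerivAt.comp z hdτ)
  have h4 := h2.unique (h3.congr_of_eventuallyEq h1)
  refine (congrArg (fun L => L v) h4).trans ?_
  simp only [_root_.add_apply, ContinuousLinearMap.comp_apply, ContinuousLinearMap.flip_apply,
    ContinuousLinearMap.apply_apply, Function.comp_apply]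
  exact add_comm _ _

/-- The Levi form is natural under holomorphic maps. -/
theorem fderiv_fderiv_comp_add_smul_I {f : Cn n → ℝ} {τ : Cn n → Cn n} {z : Cn n}
    (hf : ContDiffAt ℝ 2 f (τ z)) (hτ : ContDiffAt ℂ 2 τ z) (v : Cn n) :
    fderiv ℝ (fderiv ℝ (f ∘ τ)) z v v
        + fderiv ℝ (fderiv ℝ (f ∘ τ)) z (Complex.I • v) (Complex.I • v)
      = fderiv ℝ (fderiv ℝ f) (τ z) (fderiv ℝ τ z v) (fderiv ℝ τ z v)
        + fderiv ℝ (fderiv ℝ f) (τ z) (Complex.I • fderiv ℝ τ z v)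
          (Complex.I • fderiv ℝ τ z v) := by
  have hτr : ContDiffAt ℝ 2 τ z := hτ.restrict_scalars ℝ
  rw [fderiv_fderiv_comp_apply_self hf hτr, fderiv_fderiv_comp_apply_self hf hτr,
    fderiv_fderiv_smul_I_smul_I hτ, fderiv_real_smul_I (hτ.differentiableAt (by simp)), map_neg]
  ring

theorem eventually_symm_eq_symm_transition {X : Type*} [TopologicalSpace X]
    {e e' : OpenPartialHomeomorph X (Cn n)} {x : X} (hx : x ∈ e.source) (hx' : x ∈ e'.source) :
    ∀ᶠ z in 𝓝 (e' x), e'.symm z = e.symm ((e ∘ e'.symm) z) := by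
  have hmem : e' x ∈ (e'.symm.trans e).source := by simp [hx, hx']
  filter_upwards [(e'.symm.trans e).open_source.mem_nhds hmem] with z hz
  rw [OpenPartialHomeomorph.trans_source] at hz
  exact (e.left_inv hz.2).symm

variable {M : Type*} [TopologicalSpace M] [ChartedSpace (Cn n) M] [IsManifold 𝓘(ℂ, Cn n) ω M]

variable {e e' : OpenPartialHomeomorph M (Cn n)}

theorem contDiffAt_transition (he : e ∈ atlas (Cn n) M) (he' : e' ∈ atlas (Cn n) M) {x : M}
    (hx : x ∈ e.source) (hx' : x ∈ e'.source) : ContDiffAt ℂ 2 (e ∘ e'.symm) (e' x) := by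
  refine ((contDiffOn_transition he he').contDiffAt
    ((e'.symm.trans e).open_source.mem_nhds ?_)).of_le le_top
  simp [hx, hx']

theorem mfderiv_symm_eq_comp_transition (he : e ∈ atlas (Cn n) M) (he' : e' ∈ atlas (Cn n) M)
    {x : M} (hx : x ∈ e.source) (hx' : x ∈ e'.source) :
    (mfderiv 𝓘(ℝ, Cn n) 𝓘(ℝ, Cn n) e'.symm (e' x) : Cn n →L[ℝ] Cn n)
      = (mfderiv 𝓘(ℝ, Cn n) 𝓘(ℝ, Cn n) e.symm (e x) : Cn n →L[ℝ] Cn n)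
        ∘L fderiv ℝ (e ∘ e'.symm) (e' x) := by
  have hτ : HasMFDerivAt 𝓘(ℝ, Cn n) 𝓘(ℝ, Cn n) (e ∘ e'.symm) (e' x)
      (fderiv ℝ (e ∘ e'.symm) (e' x)) :=
    (((contDiffAt_transition he he' hx hx').restrict_scalars ℝ).differentiableAt
      (by simp)).hasFDerivAt.hasMFDerivAt
  have hex : (e ∘ e'.symm) (e' x) = e x := by simp [hx']
  have h1 : HasMFDerivAt 𝓘(ℝ, Cn n) 𝓘(ℝ, Cn n) e.symm ((e ∘ e'.symm) (e' x))
      (mfderiv 𝓘(ℝ, Cn n) 𝓘(ℝ, Cn n) e.symm ((e ∘ e'.symm) (e' x))) :=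
    ((mdifferentiable_atlas he).mdifferentiableAt_symm
      (by rw [hex]; exact e.map_source hx)).hasMFDerivAt
  have h2 := (h1.comp (e' x) hτ).congr_of_eventuallyEq
    (eventually_symm_eq_symm_transition hx hx')
  have h3 : (mfderiv 𝓘(ℝ, Cn n) 𝓘(ℝ, Cn n) e'.symm (e' x) : Cn n →L[ℝ] Cn n) = _ := h2.mfderiv
  rw [h3, ← hex]
  rfl

namespace HermitianMetric

variable (g : HermitianMetric n M)

theorem metricForm_eq_transition (he : e ∈ atlas (Cn n) M) (he' : e' ∈ atlas (Cn n) M)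
    {x : M} (hx : x ∈ e.source) (hx' : x ∈ e'.source) (v w : Cn n) :
    g.metricForm e' (e' x) v w = g.metricForm e (e x) (fderiv ℝ (e ∘ e'.symm) (e' x) v)
      (fderiv ℝ (e ∘ e'.symm) (e' x) w) := by
  unfold metricForm
  rw [e.left_inv hx, e'.left_inv hx', mfderiv_symm_eq_comp_transition he he' hx hx']
  rfl

/-- The transition derivative is complex linear and injective, and it carries the criterion of
`posDef_levi_iff` in one chart to that in the other. -/
theorem posDef_levi_potentialForm_of_mem_source {φ : M → ℝ}
    (hφ : ContMDiff 𝓘(ℝ, Cn n) 𝓘(ℝ, ℝ) 2 φ) (he : e ∈ atlas (Cn n) M) (he' : e' ∈ atlas (Cn n) M)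
    {x : M} (hx : x ∈ e.source) (hx' : x ∈ e'.source)
    (h : (levi (g.potentialForm φ e (e x))).PosDef) :
    (levi (g.potentialForm φ e' (e' x))).PosDef := by
  rw [posDef_levi_iff (g.potentialForm_comm hφ he (e.map_source hx))] at h
  rw [posDef_levi_iff (g.potentialForm_comm hφ he' (e'.map_source hx'))]
  intro v hv
  have hτ := contDiffAt_transition he he' hx hx'
  have hex : (e ∘ e'.symm) (e' x) = e x := by simp [hx']
  -- Injectivity is read off from the metric: a vector in the kernel would have zero length.
  have hne : fderiv ℝ (e ∘ e'.symm) (e' x) v ≠ 0 := fun h0 => by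
    have h1 := g.metricForm_pos he' (e'.map_source hx') hv
    rw [g.metricForm_eq_transition he he' hx hx', h0, map_zero] at h1
    exact lt_irrefl _ h1
  have hφe : φ ∘ e'.symm =ᶠ[𝓝 (e' x)] (φ ∘ e.symm) ∘ (e ∘ e'.symm) :=
    (eventually_symm_eq_symm_transition hx hx').mono fun z hz => congrArg φ hz
  have h2 := fderiv_fderiv_comp_add_smul_I (f := φ ∘ e.symm)
    (by rw [hex]; exact contDiffAt_comp_symm hφ he (e.map_source hx)) hτ v
  rw [hex] at h2
  have h3 := h _ hne
  have hI := fderiv_real_smul_I (hτ.differentiableAt (by simp)) v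
  simp only [potentialForm, _root_.add_apply] at h3 ⊢
  rw [hφe.fderiv.fderiv_eq, g.metricForm_eq_transition he he' hx hx',
    g.metricForm_eq_transition he he' hx hx', hI]
  linarith

end HermitianMetric

end ChangeOfCoordinates

/-! ### Positivity of solutions and constancy of their difference. -/

section Rigidity

variable {n : ℕ} {M : Type*} [TopologicalSpace M] [ChartedSpace (Cn n) M]
  [IsManifold 𝓘(ℂ, Cn n) ω M]

namespace HermitianMetric

variable (g : HermitianMetric n M)

theorem posDef_coeff {e : OpenPartialHomeomorph M (Cn n)} (he : e ∈ atlas (Cn n) M) {z : Cn n}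
    (hz : z ∈ e.target) : (g.coeff e z).PosDef := by
  rw [coeff_eq_levi, posDef_levi_iff (g.metricForm_comm e z)]
  intro v hv
  exact add_pos (g.metricForm_pos he hz hv)
    (g.metricForm_pos he hz (smul_ne_zero Complex.I_ne_zero hv))

/-- The set of points at which `g_{ij̄} + ∂²φ/∂zⁱ∂z̄ʲ` is positive definite. -/
def positiveSet (φ : M → ℝ) : Set M :=
  {x | (levi (g.potentialForm φ (chartAt (Cn n) x) (chartAt (Cn n) x x))).PosDef}

theorem mem_positiveSet_iff {φ : M → ℝ} (hφ : ContMDiff 𝓘(ℝ, Cn n) 𝓘(ℝ, ℝ) 2 φ)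
    {e : OpenPartialHomeomorph M (Cn n)} (he : e ∈ atlas (Cn n) M) {x : M} (hx : x ∈ e.source) :
    x ∈ g.positiveSet φ ↔ (levi (g.potentialForm φ e (e x))).PosDef :=
  ⟨g.posDef_levi_potentialForm_of_mem_source hφ (chart_mem_atlas _ x) he (mem_chart_source _ x) hx,
    g.posDef_levi_potentialForm_of_mem_source hφ he (chart_mem_atlas _ x) hx
      (mem_chart_source _ x)⟩

theorem continuous_potentialForm_comp {φ : M → ℝ} (hφ : ContMDiff 𝓘(ℝ, Cn n) 𝓘(ℝ, ℝ) 2 φ)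
    {e : OpenPartialHomeomorph M (Cn n)} (he : e ∈ atlas (Cn n) M) :
    Continuous fun x : e.source => g.potentialForm φ e (e x) :=
  (g.continuousOn_potentialForm hφ he).comp_continuous
    (continuousOn_iff_continuous_domRestrict.mp e.continuousOn) fun x => e.map_source x.2

theorem isOpen_positiveSet {φ : M → ℝ} (hφ : ContMDiff 𝓘(ℝ, Cn n) 𝓘(ℝ, ℝ) 2 φ) :
    IsOpen (g.positiveSet φ) := by
  rw [isOpen_iff_mem_nhds]
  intro x hx
  have hs := (chartAt (Cn n) x).open_source
  have h := isOpen_setOf_posDef_levi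
    (g.continuous_potentialForm_comp hφ (chart_mem_atlas (Cn n) x))
    fun y => g.potentialForm_comm hφ (chart_mem_atlas _ x) ((chartAt (Cn n) x).map_source y.2)
  refine Filter.mem_of_superset ((hs.isOpenMap_subtype_val _ h).mem_nhds
    ⟨⟨x, mem_chart_source _ x⟩, hx, rfl⟩) ?_
  rintro _ ⟨y, hy, rfl⟩
  exact (g.mem_positiveSet_iff hφ (chart_mem_atlas _ x) y.2).mpr hy

/-- A limit of positive definite matrices is positive semidefinite, and a nonzero determinant makes
it definite. -/
theorem isClosed_positiveSet {φ : M → ℝ} (hφ : ContMDiff 𝓘(ℝ, Cn n) 𝓘(ℝ, ℝ) 2 φ)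
    (hdet : ∀ e ∈ atlas (Cn n) M, ∀ z ∈ e.target, (levi (g.potentialForm φ e z)).det ≠ 0) :
    IsClosed (g.positiveSet φ) := by
  rw [← isOpen_compl_iff, isOpen_iff_mem_nhds]
  intro x hx
  have hs := (chartAt (Cn n) x).open_source
  have he := chart_mem_atlas (Cn n) x
  have h := (isClosed_setOf_posSemidef_levi (g.continuous_potentialForm_comp hφ he)
    fun y => g.potentialForm_comm hφ he ((chartAt (Cn n) x).map_source y.2)).isOpen_compl
  refine Filter.mem_of_superset ((hs.isOpenMap_subtype_val _ h).mem_nhds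
    ⟨⟨x, mem_chart_source _ x⟩, fun hsemi => hx ?_, rfl⟩) ?_
  · exact Matrix.PosSemidef.posDef_of_det_ne_zero hsemi
      (hdet _ he _ ((chartAt (Cn n) x).map_source (mem_chart_source _ x)))
  · rintro _ ⟨y, hy, rfl⟩ hmem
    exact hy ((g.mem_positiveSet_iff hφ he y.2).mp hmem).posSemidef

theorem mem_positiveSet_of_isMin {φ : M → ℝ} (hφ : ContMDiff 𝓘(ℝ, Cn n) 𝓘(ℝ, ℝ) 2 φ) {x : M}
    (hx : ∀ y, φ x ≤ φ y) : x ∈ g.positiveSet φ := by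
  have he := chart_mem_atlas (Cn n) x
  have hz := (chartAt (Cn n) x).map_source (mem_chart_source _ x)
  have hmax : IsLocalMax (fun w => -(φ ∘ (chartAt (Cn n) x).symm) w) (chartAt (Cn n) x x) := by
    refine Filter.Eventually.of_forall fun w => neg_le_neg ?_
    rw [Function.comp_apply, Function.comp_apply,
      (chartAt (Cn n) x).left_inv (mem_chart_source _ x)]
    exact hx _
  have h := posSemidef_neg_levi_of_isLocalMax hmax (contDiffAt_comp_symm hφ he hz).neg
  rw [fderiv_fderiv_neg, levi_neg, neg_neg] at h
  rw [positiveSet, Set.mem_ofPred_eq, potentialForm, levi_add]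
  exact (g.posDef_coeff he hz).add_posSemidef h

theorem det_levi_potentialForm {F φ : M → ℝ} {C : ℝ} (h : g.SolvesMongeAmpere F C φ)
    (hφ : ContMDiff 𝓘(ℝ, Cn n) 𝓘(ℝ, ℝ) 2 φ) {e : OpenPartialHomeomorph M (Cn n)}
    (he : e ∈ atlas (Cn n) M) {z : Cn n} (hz : z ∈ e.target) :
    (levi (g.potentialForm φ e z)).det = (C * Real.exp (F (e.symm z)) : ℝ) * (g.coeff e z).det := by
  rw [g.levi_potentialForm hφ he hz]
  exact h e he z hz

/-- A solution of the Monge–Ampère equation on a compact connected manifold is automatically a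
Kähler potential: `g_{ij̄} + ∂²φ/∂zⁱ∂z̄ʲ` is positive definite. -/
theorem SolvesMongeAmpere.posDef [CompactSpace M] [ConnectedSpace M] {g : HermitianMetric n M}
    {F φ : M → ℝ} {C : ℝ} (hC : 0 < C) (h : g.SolvesMongeAmpere F C φ)
    (hφ : ContMDiff 𝓘(ℝ, Cn n) 𝓘(ℝ, ℝ) 2 φ) {e : OpenPartialHomeomorph M (Cn n)}
    (he : e ∈ atlas (Cn n) M) {z : Cn n} (hz : z ∈ e.target) :
    (levi (g.potentialForm φ e z)).PosDef := by
  have hdet : ∀ e ∈ atlas (Cn n) M, ∀ z ∈ e.target, (levi (g.potentialForm φ e z)).det ≠ 0 := by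
    intro e he z hz
    rw [g.det_levi_potentialForm h hφ he hz]
    exact mul_ne_zero (Complex.ofReal_ne_zero.mpr (by positivity)) (g.posDef_coeff he hz).det_pos.ne'
  obtain ⟨x, hx⟩ := hφ.continuous.exists_forall_le_of_hasCompactSupport
    (HasCompactSupport.of_compactSpace φ)
  -- The positive set is clopen and contains a minimum point of `φ`.
  have huniv := IsClopen.eq_univ ⟨g.isClosed_positiveSet hφ hdet, g.isOpen_positiveSet hφ⟩
    ⟨x, g.mem_positiveSet_of_isMin hφ hx⟩
  have h1 := (g.mem_positiveSet_iff hφ he (e.map_target hz)).mp (huniv ▸ Set.mem_univ _)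
  rwa [e.right_inv hz] at h1

/-- Two solutions of the same Monge–Ampère equation differ by a constant. -/
theorem SolvesMongeAmpere.exists_sub_eq_const [CompactSpace M] [ConnectedSpace M]
    {g : HermitianMetric n M} {F φ₁ φ₂ : M → ℝ} {C : ℝ} (hC : 0 < C)
    (h₁ : g.SolvesMongeAmpere F C φ₁) (h₂ : g.SolvesMongeAmpere F C φ₂)
    (hφ₁ : ContMDiff 𝓘(ℝ, Cn n) 𝓘(ℝ, ℝ) 2 φ₁) (hφ₂ : ContMDiff 𝓘(ℝ, Cn n) 𝓘(ℝ, ℝ) 2 φ₂) :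
    ∃ c, ∀ x, φ₁ x - φ₂ x = c := by
  have hcont : Continuous fun x => φ₁ x - φ₂ x := hφ₁.continuous.sub hφ₂.continuous
  obtain ⟨p, hp⟩ := hcont.exists_forall_ge_of_hasCompactSupport
    (HasCompactSupport.of_compactSpace _)
  have hclosed : IsClosed {x | φ₁ x - φ₂ x = φ₁ p - φ₂ p} := isClosed_eq hcont continuous_const
  have hopen : IsOpen {x | φ₁ x - φ₂ x = φ₁ p - φ₂ p} := by
    rw [isOpen_iff_mem_nhds]
    intro x hx
    rw [Set.mem_ofPred_eq] at hx
    have he := chart_mem_atlas (Cn n) x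
    set e := chartAt (Cn n) x with hedef
    have hxs : x ∈ e.source := mem_chart_source _ x
    have hu : ContDiffOn ℝ 2 (fun z => (φ₁ ∘ e.symm) z + (-1) * (φ₂ ∘ e.symm) z) e.target :=
      (contDiffOn_comp_symm hφ₁ he).add (contDiffOn_const.mul (contDiffOn_comp_symm hφ₂ he))
    have hpd₁ {z} (hz : z ∈ e.target) := h₁.posDef hC hφ₁ he hz
    have hpd₂ {z} (hz : z ∈ e.target) := h₂.posDef hC hφ₂ he hz
    have hcA : ContinuousOn (fun z => levi (g.potentialForm φ₂ e z)) e.target :=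
      continuous_levi.comp_continuousOn (g.continuousOn_potentialForm hφ₂ he)
    have hcP : ContinuousOn (fun z => (levi (g.potentialForm φ₂ e z))⁻¹) e.target := by
      simp only [Matrix.inv_def, Ring.inverse_eq_inv']
      exact ((continuous_id.matrix_det.comp_continuousOn hcA).inv₀
        fun z hz => (hpd₂ hz).det_pos.ne').smul (continuous_id.matrix_adjugate.comp_continuousOn hcA)
    -- The linear operator has coefficient matrix `A₂⁻¹`, continuous because `φ₂` is `C²` and `det
    -- A₂` does not vanish.
    have hmax := eventually_eq_of_isMax e.open_target hu hcP (fun z hz => (hpd₂ hz).inv)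
      (fun z hz => ?_) (p := e x) (fun z hz => ?_) (e.map_source hxs)
    · have h3 := (e.continuousAt hxs).eventually hmax
      filter_upwards [h3, e.open_source.mem_nhds hxs] with y hy hys
      simp only [Function.comp_apply, e.left_inv hys, e.left_inv hxs] at hy
      rw [← hx]
      linarith
    · rw [fderiv_fderiv_add_smul (contDiffAt_comp_symm hφ₁ he hz) (contDiffAt_comp_symm hφ₂ he hz),
        levi_add, levi_smul]
      -- Both determinants equal `C e^F det g`, and `g` cancels in the difference of the two
      -- matrices.
      have h3 := trace_inv_mul_sub_nonneg (hpd₁ hz) (hpd₂ hz) (by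
        rw [g.det_levi_potentialForm h₁ hφ₁ he hz, g.det_levi_potentialForm h₂ hφ₂ he hz])
      convert h3 using 4
      simp only [potentialForm, levi_add]
      module
    · have h3 := hp (e.symm z)
      simp only [Function.comp_apply, e.left_inv hxs]
      linarith
  have huniv := IsClopen.eq_univ ⟨hclosed, hopen⟩ ⟨p, rfl⟩
  exact ⟨φ₁ p - φ₂ p, fun x => Set.eq_univ_iff_forall.mp huniv x⟩

end HermitianMetric

end Rigidity

/-! ### The Riemannian volume is finite and nonzero. -/

section Volume

open MeasureTheory

variable {n : ℕ} {M : Type*} [TopologicalSpace M] [ChartedSpace (Cn n) M]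
  [IsManifold 𝓘(ℂ, Cn n) ω M]

theorem sum_smul_ex_ey_ne_zero {x : Fin n ⊕ Fin n → ℝ} (hx : x ≠ 0) :
    ∑ a, x a • (Sum.elim ex ey a : Cn n) ≠ 0 := by
  intro h
  refine hx (funext fun a => ?_)
  have hk (k : Fin n) : (x (Sum.inl k) : ℂ) + x (Sum.inr k) * Complex.I = 0 := by
    have := congrFun h k
    simpa [Fintype.sum_sum_type, ex, ey, Pi.single_apply] using this
  rcases a with k | k
  · simpa using congrArg Complex.re (hk k)
  · simpa using congrArg Complex.im (hk k)

namespace HermitianMetric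

variable (g : HermitianMetric n M)

theorem volumeDensity_pos {e : OpenPartialHomeomorph M (Cn n)} (he : e ∈ atlas (Cn n) M)
    {z : Cn n} (hz : z ∈ e.target) : 0 < g.volumeDensity e z := by
  refine Real.sqrt_pos.mpr (Matrix.PosDef.det_pos ?_)
  refine .of_dotProduct_mulVec_pos ?_ fun x hx => ?_
  · ext a b
    exact g.metricForm_comm e z _ _
  · have h := g.metricForm_pos he hz (sum_smul_ex_ey_ne_zero hx)
    rw [map_sum (g.metricForm e z), _root_.sum_apply] at h
    simp only [map_sum, map_smul, _root_.smul_apply, smul_eq_mul] at h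
    simpa only [dotProduct, mulVec, Matrix.of_apply, Pi.star_apply, star_trivial, Finset.mul_sum,
      ← metricForm_apply, mul_left_comm, mul_comm] using h

theorem continuousOn_volumeDensity {e : OpenPartialHomeomorph M (Cn n)}
    (he : e ∈ atlas (Cn n) M) : ContinuousOn (g.volumeDensity e) e.target := by
  refine Real.continuous_sqrt.comp_continuousOn (continuous_id.matrix_det.comp_continuousOn ?_)
  exact continuousOn_pi.mpr fun a => continuousOn_pi.mpr fun b => g.continuousOn_localMetric he _ _

variable [T2Space M] [CompactSpace M]

theorem chartPartition_isSubordinate :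
    (chartPartition n M).IsSubordinate fun x => (chartAt (Cn n) x).source :=
  (SmoothPartitionOfUnity.exists_isSubordinate_chartAt_source 𝓘(ℝ, Cn n) M).choose_spec

/-- The density of the `p`-th summand of the Riemannian volume. -/
def partialDensity (p : M) (z : Cn n) : ℝ :=
  chartPartition n M p ((chartAt (Cn n) p).symm z) * g.volumeDensity (chartAt (Cn n) p) z

theorem continuousOn_partialDensity (p : M) :
    ContinuousOn (g.partialDensity p) (chartAt (Cn n) p).target :=
  ((chartPartition n M p).contMDiff.continuous.comp_continuousOn
    (chartAt (Cn n) p).continuousOn_symm).mul (g.continuousOn_volumeDensity (chart_mem_atlas _ p))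

/-- The density vanishes off the compact image of the support of the partition function, and there
it is bounded by continuity. -/
theorem lintegral_partialDensity_lt_top (p : M) :
    ∫⁻ z in (chartAt (Cn n) p).target, ENNReal.ofReal (g.partialDensity p z) < ⊤ := by
  set e := chartAt (Cn n) p with hedef
  have hsub : tsupport (chartPartition n M p) ⊆ e.source := chartPartition_isSubordinate p
  have hK : IsCompact (e '' tsupport (chartPartition n M p)) :=
    (isClosed_tsupport _).isCompact.image_of_continuousOn (e.continuousOn.mono hsub)
  have hKt : e '' tsupport (chartPartition n M p) ⊆ e.target := by
    rintro _ ⟨x, hx, rfl⟩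
    exact e.map_source (hsub hx)
  obtain ⟨c, hc⟩ := (hK.image_of_continuousOn
    ((g.continuousOn_partialDensity p).mono hKt)).bddAbove
  have hle : ∀ z ∈ e.target, ENNReal.ofReal (g.partialDensity p z)
      ≤ (e '' tsupport (chartPartition n M p)).indicator (fun _ => ENNReal.ofReal c) z := by
    intro z hz
    by_cases hzK : z ∈ e '' tsupport (chartPartition n M p)
    · rw [Set.indicator_of_mem hzK]
      exact ENNReal.ofReal_le_ofReal (hc ⟨z, hzK, rfl⟩)
    · have h0 : chartPartition n M p (e.symm z) = 0 := by
        by_contra hne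
        exact hzK ⟨e.symm z, subset_tsupport _ hne, e.right_inv hz⟩
      simp [partialDensity, ← hedef, h0]
  calc ∫⁻ z in e.target, ENNReal.ofReal (g.partialDensity p z)
      ≤ ∫⁻ z in e.target, (e '' tsupport (chartPartition n M p)).indicator
          (fun _ => ENNReal.ofReal c) z := setLIntegral_mono' e.open_target.measurableSet hle
    _ ≤ ∫⁻ z, (e '' tsupport (chartPartition n M p)).indicator (fun _ => ENNReal.ofReal c) z :=
        setLIntegral_le_lintegral _ _
    _ = ENNReal.ofReal c * volume (e '' tsupport (chartPartition n M p)) :=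
        lintegral_indicator_const hK.measurableSet _
    _ < ⊤ := ENNReal.mul_lt_top ENNReal.ofReal_lt_top hK.measure_lt_top

/-- The density is continuous and positive at the image of `x`, hence positive on a nonempty open
set. -/
theorem lintegral_partialDensity_pos {p x : M} (hx : 0 < chartPartition n M p x) :
    0 < ∫⁻ z in (chartAt (Cn n) p).target, ENNReal.ofReal (g.partialDensity p z) := by
  set e := chartAt (Cn n) p with hedef
  have hxs : x ∈ e.source := chartPartition_isSubordinate p (subset_tsupport _ hx.ne')
  have hc := g.continuousOn_partialDensity p
  rw [pos_iff_ne_zero]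
  intro h0
  rw [lintegral_eq_zero_iff' (hc.aemeasurable e.open_target.measurableSet).ennreal_ofReal] at h0
  have h1 := (ae_restrict_iff' e.open_target.measurableSet).mp h0
  have hW : IsOpen (e.target ∩ g.partialDensity p ⁻¹' Set.Ioi 0) :=
    hc.isOpen_inter_preimage e.open_target isOpen_Ioi
  have hne : (e.target ∩ g.partialDensity p ⁻¹' Set.Ioi 0).Nonempty := by
    refine ⟨e x, e.map_source hxs, ?_⟩
    rw [Set.mem_preimage, Set.mem_Ioi, partialDensity, ← hedef, e.left_inv hxs]
    exact mul_pos hx (g.volumeDensity_pos (chart_mem_atlas _ p) (e.map_source hxs))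
  refine (hW.measure_pos volume hne).ne' (measure_mono_null ?_ h1)
  rintro z ⟨hz, hpos⟩ hz0
  exact absurd (ENNReal.ofReal_eq_zero.mp (hz0 hz)) (not_le.mpr hpos)

variable [MeasurableSpace M] [BorelSpace M]

theorem volumeMeasure_univ : g.volumeMeasure Set.univ
    = ∑' p : M, ∫⁻ z in (chartAt (Cn n) p).target, ENNReal.ofReal (g.partialDensity p z) := by
  rw [volumeMeasure, Measure.sum_apply _ MeasurableSet.univ]
  refine tsum_congr fun p => ?_
  have hm : AEMeasurable (chartAt (Cn n) p).symm
      ((volume : Measure (Cn n)).restrict (chartAt (Cn n) p).target) :=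
    (chartAt (Cn n) p).continuousOn_symm.aemeasurable (chartAt (Cn n) p).open_target.measurableSet
  rw [Measure.map_apply_of_aemeasurable (hm.mono_ac (withDensity_absolutelyContinuous _ _))
    MeasurableSet.univ, Set.preimage_univ, withDensity_apply _ MeasurableSet.univ,
    Measure.restrict_univ]
  rfl

theorem isFiniteMeasure_volumeMeasure : IsFiniteMeasure g.volumeMeasure := by
  refine ⟨?_⟩
  -- By compactness only finitely many partition functions are nonzero, so the sum is finite.
  have hfin := (chartPartition n M).locallyFinite.finite_nonempty_of_compact
  rw [volumeMeasure_univ, tsum_eq_sum (s := hfin.toFinset)]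
  · exact ENNReal.sum_lt_top.mpr fun p _ => g.lintegral_partialDensity_lt_top p
  · intro p hp
    have h0 (x : M) : chartPartition n M p x = 0 := by
      by_contra hne
      exact hp (hfin.mem_toFinset.mpr ⟨x, hne⟩)
    simp [partialDensity, h0]

theorem volumeMeasure_univ_ne_zero [Nonempty M] : g.volumeMeasure Set.univ ≠ 0 := by
  obtain ⟨x⟩ := ‹Nonempty M›
  obtain ⟨p, hp⟩ := (chartPartition n M).exists_pos_of_mem (Set.mem_univ x)
  rw [volumeMeasure_univ]
  intro h0
  exact (g.lintegral_partialDensity_pos hp).ne' (ENNReal.tsum_eq_zero.mp h0 p)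

end HermitianMetric

end Volume

end KahlerUniqueness

end

theorem mainTheorem4 {n : ℕ} {M : Type*} [TopologicalSpace M] [T2Space M] [CompactSpace M]
    [ConnectedSpace M] [ChartedSpace (KahlerUniqueness.Cn n) M]
    [IsManifold 𝓘(ℂ, KahlerUniqueness.Cn n) ω M] [MeasurableSpace M] [BorelSpace M]
    (g : KahlerUniqueness.HermitianMetric n M) (hg : g.IsKahler)
    (F : M → ℝ) (hF : ContMDiff 𝓘(ℝ, KahlerUniqueness.Cn n) 𝓘(ℝ, ℝ) ∞ F)
    (C : ℝ) (hC : 0 < C)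
    (hCF : C * ∫ x, Real.exp (F x) ∂g.volumeMeasure = g.volumeMeasure.real Set.univ)
    (φ₁ φ₂ : M → ℝ)
    (hφ₁ : ContMDiff 𝓘(ℝ, KahlerUniqueness.Cn n) 𝓘(ℝ, ℝ) 3 φ₁)
    (hφ₂ : ContMDiff 𝓘(ℝ, KahlerUniqueness.Cn n) 𝓘(ℝ, ℝ) 3 φ₂)
    (h₁ : g.SolvesMongeAmpere F C φ₁) (h₂ : g.SolvesMongeAmpere F C φ₂)
    (hm₁ : ∫ x, φ₁ x ∂g.volumeMeasure = 0) (hm₂ : ∫ x, φ₂ x ∂g.volumeMeasure = 0) :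
    φ₁ = φ₂ := by
  have h23 : (2 : ℕ∞ω) ≤ 3 := by norm_num
  obtain ⟨c, hc⟩ := h₁.exists_sub_eq_const hC h₂ (hφ₁.of_le h23) (hφ₂.of_le h23)
  have hfin := g.isFiniteMeasure_volumeMeasure
  have hint {φ : M → ℝ} (hφ : Continuous φ) : MeasureTheory.Integrable φ g.volumeMeasure :=
    hφ.integrable_of_hasCompactSupport (HasCompactSupport.of_compactSpace φ)
  have h := MeasureTheory.integral_sub (hint hφ₁.continuous) (hint hφ₂.continuous)
  -- The integral of the constant difference is the total volume times `c`, and it is zero.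
  simp only [hc, hm₁, hm₂, MeasureTheory.integral_const, sub_self, smul_eq_mul] at h
  have hvol : g.volumeMeasure.real Set.univ ≠ 0 :=
    (MeasureTheory.measureReal_ne_zero_iff).mpr g.volumeMeasure_univ_ne_zero
  have hc0 : c = 0 := (mul_eq_zero.mp h).resolve_left hvol
  funext x
  exact sub_eq_zero.mp ((hc x).trans hc0)
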